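/- Let $m\in(-1,1)$ and consider four labelled point vortices at distinct positions $x_1,\dots,x_4\in\mathbb{R}^2$ with strengths $\Gamma_1=\Gamma_2=1$ and $\Gamma_3=\Gamma_4=m$. The configuration $x=(x_1,\dots,x_4)$ is called a relative equilibrium if there are $\lambda\in\mathbb{R}\setminus\{0\}$ and $c\in\mathbb{R}^2$ with $$-\lambda\,(x_i-c)=\sum_{j\neq i}\frac{\Gamma_j}{\|x_i-x_j\|^2}\,(x_j-x_i)\qquad (i=1,2,3,4).$$ It is strictly planar if its four points do not all lie on one line, and asymmetric if no reflection in a line maps the set $\{x_1,\dots,x_4\}$ onto itself. It is concave if no three of its points are collinear and one point lies in the interior of the convex hull of the other three, and convex if no three of its points are collinear and no point lies in the convex hull of the other three. Configurations are counted as labelled configurations, up to rotation, scaling and translation. Then there are exactly eight strictly planar asymmetric relative equilibria up to rotation, scaling and translation, and exactly four if configurations that differ by a reflection are also identified. If $m<0$ all of them are convex, and if $m>0$ all of them are concave. -/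

import Mathlib

/-! Point vortices in the plane; the plane `ℝ²` is identified with `ℂ` throughout. -/

namespace FourVortex

/-- Positions `x i` of `n` pairwise distinct point vortices of strengths `Γ i` form a relative
equilibrium (central configuration) if, for some angular velocity `ω ≠ 0` and some center of
rotation `c`, one has `-ω (x i - c) = ∑_{j ≠ i} Γ j / ‖x i - x j‖ ^ 2 • (x j - x i)` for all `i`. -/
def IsRelativeEquilibrium {n : ℕ} (Γ : Fin n → ℝ) (x : Fin n → ℂ) : Prop :=
  Function.Injective x ∧
    ∃ ω : ℝ, ω ≠ 0 ∧ ∃ c : ℂ, ∀ i,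
      -(ω • (x i - c)) = ∑ j ∈ Finset.univ.erase i, (Γ j / ‖x i - x j‖ ^ 2) • (x j - x i)

/-- The vortex strengths `Γ₁ = Γ₂ = 1`, `Γ₃ = Γ₄ = m`. -/
def strength (m : ℝ) : Fin 4 → ℝ := ![1, 1, m, m]

/-- A planar configuration is strictly planar if it is not collinear. -/
def IsStrictlyPlanar {n : ℕ} (x : Fin n → ℂ) : Prop :=
  ¬ Collinear ℝ (Set.range x)

/-- The orthogonal reflection of the plane in the line through `p` with unit direction `u`. -/
noncomputable def lineReflection (p u z : ℂ) : ℂ :=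
  p + u ^ 2 * (starRingEnd ℂ) (z - p)

/-- The configuration has a line of symmetry: the reflection in some line maps the set of
positions onto itself. -/
def HasLineOfSymmetry {n : ℕ} (x : Fin n → ℂ) : Prop :=
  ∃ p u : ℂ, ‖u‖ = 1 ∧ lineReflection p u '' Set.range x = Set.range x

/-- Some three vortices lie on a line. -/
def HasCollinearTriple {n : ℕ} (x : Fin n → ℂ) : Prop :=
  ∃ i j k : Fin n, i ≠ j ∧ i ≠ k ∧ j ≠ k ∧ Collinear ℝ {x i, x j, x k}

/-- Concave: no three of the four vortices are collinear and one of them lies strictly inside the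
convex hull of the other three. -/
def IsConcave (x : Fin 4 → ℂ) : Prop :=
  ¬ HasCollinearTriple x ∧ ∃ i, x i ∈ interior (convexHull ℝ (x '' {i}ᶜ))

/-- Convex: no three of the four vortices are collinear and none of them lies in the
convex hull of the other three. -/
def IsConvex (x : Fin 4 → ℂ) : Prop :=
  ¬ HasCollinearTriple x ∧ ∀ i, x i ∉ convexHull ℝ (x '' {i}ᶜ)

/-- The strictly planar asymmetric relative equilibria with strengths `1, 1, m, m`. -/
def asymmetricEquilibria (m : ℝ) : Set (Fin 4 → ℂ) :=
  {x | IsRelativeEquilibrium (strength m) x ∧ IsStrictlyPlanar x ∧ ¬ HasLineOfSymmetry x}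

/-- `y` arises from `x` by a rotation, a scaling and a translation: the map `z ↦ a z + b` with
`a ≠ 0` rotates by `arg a`, scales by `‖a‖` and translates by `b`. The labels are kept. -/
def DirectlySimilar {n : ℕ} (x y : Fin n → ℂ) : Prop :=
  ∃ a b : ℂ, a ≠ 0 ∧ ∀ i, y i = a * x i + b

/-- The mirror image of a configuration (in the real axis). -/
noncomputable def mirror {n : ℕ} (x : Fin n → ℂ) : Fin n → ℂ :=
  fun i => (starRingEnd ℂ) (x i)

/-- `y` arises from `x` by a rotation, a scaling, a translation and possibly a reflection. -/
def Similar {n : ℕ} (x y : Fin n → ℂ) : Prop :=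
  DirectlySimilar x y ∨ DirectlySimilar (mirror x) y

theorem DirectlySimilar.refl {n : ℕ} (x : Fin n → ℂ) : DirectlySimilar x x :=
  ⟨1, 0, one_ne_zero, fun i => by simp⟩

theorem DirectlySimilar.symm {n : ℕ} {x y : Fin n → ℂ} (h : DirectlySimilar x y) :
    DirectlySimilar y x := by
  obtain ⟨a, b, ha, h⟩ := h
  refine ⟨a⁻¹, -(a⁻¹ * b), inv_ne_zero ha, fun i => ?_⟩
  rw [h i]
  field_simp
  ring

theorem DirectlySimilar.trans {n : ℕ} {x y z : Fin n → ℂ} (h : DirectlySimilar x y)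
    (h' : DirectlySimilar y z) : DirectlySimilar x z := by
  obtain ⟨a, b, ha, h⟩ := h
  obtain ⟨a', b', ha', h'⟩ := h'
  refine ⟨a' * a, a' * b + b', mul_ne_zero ha' ha, fun i => ?_⟩
  rw [h' i, h i]
  ring

theorem mirror_mirror {n : ℕ} (x : Fin n → ℂ) : mirror (mirror x) = x := by
  funext i
  simp [mirror]

theorem DirectlySimilar.mirror {n : ℕ} {x y : Fin n → ℂ} (h : DirectlySimilar x y) :
    DirectlySimilar (mirror x) (mirror y) := by
  obtain ⟨a, b, ha, h⟩ := h
  refine ⟨(starRingEnd ℂ) a, (starRingEnd ℂ) b, by simpa using ha, fun i => ?_⟩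
  simp [FourVortex.mirror, h i]

/-- Equivalence of configurations under rotation, scaling and translation. -/
def directSetoid (n : ℕ) : Setoid (Fin n → ℂ) where
  r := DirectlySimilar
  iseqv := ⟨DirectlySimilar.refl, DirectlySimilar.symm, DirectlySimilar.trans⟩

/-- Equivalence of configurations under rotation, scaling, translation and reflection. -/
def similarSetoid (n : ℕ) : Setoid (Fin n → ℂ) where
  r := Similar
  iseqv := by
    refine ⟨fun x => Or.inl (DirectlySimilar.refl x), ?_, ?_⟩
    · rintro x y (h | h)
      · exact Or.inl h.symm
      · exact Or.inr (by simpa only [mirror_mirror] using h.symm.mirror)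
    · rintro x y z (h | h) (h' | h')
      · exact Or.inl (h.trans h')
      · exact Or.inr (h.mirror.trans h')
      · exact Or.inr (h.trans h')
      · exact Or.inl (by simpa only [mirror_mirror] using h.mirror.trans h')

end FourVortex

/-! The argument uses Dziobek's relations. The total strength `2 * (m + 1)` is nonzero, so the
equilibrium equations read `∑ j, Γ j (r_ij⁻² - l) (x i - x j) = 0`. Each one is an affine dependency
of the four points. For a strictly planar configuration dependencies are unique up to scale and
given by the signed areas Δ. Writing Δ i = Γ i * p i with `m ≠ 0`, the symmetric matrix `r_ij⁻² - l`
therefore has rank one off the diagonal: `r_ij⁻² = l (1 + n p_i p_j)`.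

The sum `∑ j, Δ j r_ij²` does not depend on i, which gives four rational equations in the p_i,
together with `p₁ + p₂ + m (p₃ + p₄) = 0`. Equal values p₁ = p₂ or p₃ = p₄, and also p₃ + p₄ = 0,
force a line of symmetry. Once these are excluded, elimination in V = n p₁p₂, X = n p₃p₄, W = n (p₃
+ p₄)² yields `(m X - 1) (V - m) = 0` (`product_formula`). The first factor leads to a negative
square; the second determines V, X and W (`product_values`).

Consequently, with A² = m + 1, B² = 3m + 5, C² = 1 - m and R² = 3, every solution is similar to
`conf A B C R`. Fixing A > 0 leaves three free signs, hence eight classes, and a reflection changes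
only the sign of R. For `m = 0` the division by Γ fails, but a direct computation of the equilibria
of a zero vortex gives the same family. Conversely, all eight configurations are equilibria, and the
distinct squares of their dependency coefficients rule out a symmetry. The signs of these
coefficients, with D₀D₁ < 0 and D₂D₃ = 2m, decide between convex and concave. -/

namespace FourVortex

/-! ### Elimination in the rational equations for p₁, …, p₄. -/

section Algebra

variable {m n p₁ p₂ p₃ p₄ θ : ℝ}

/-- Difference of the potential equations of two equal vortices. -/
theorem pair_equation {g k a b c d : ℝ} (hne : a ≠ b)
    (hab : 1 + n * (a * b) ≠ 0)
    (hac : 1 + n * (a * c) ≠ 0) (had : 1 + n * (a * d) ≠ 0)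
    (hbc : 1 + n * (b * c) ≠ 0) (hbd : 1 + n * (b * d) ≠ 0)
    (h : g * b / (1 + n * (a * b)) + k * c / (1 + n * (a * c)) + k * d / (1 + n * (a * d)) =
      g * a / (1 + n * (a * b)) + k * c / (1 + n * (b * c)) + k * d / (1 + n * (b * d))) :
    g * ((1 + n * (a * c)) * (1 + n * (a * d)) * (1 + n * (b * c)) * (1 + n * (b * d))) +
      k * n * (1 + n * (a * b)) * (c ^ 2 * ((1 + n * (a * d)) * (1 + n * (b * d))) +
        d ^ 2 * ((1 + n * (a * c)) * (1 + n * (b * c)))) = 0 := by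
  have h' : (b - a) ≠ 0 := sub_ne_zero.2 hne.symm
  apply mul_left_cancel₀ h'
  have key : ∀ t₀ t₁ t₂ t₃ t₄ : ℝ, t₀ ≠ 0 → t₁ ≠ 0 → t₂ ≠ 0 → t₃ ≠ 0 → t₄ ≠ 0 →
      g * b / t₀ + k * c / t₁ + k * d / t₂ = g * a / t₀ + k * c / t₃ + k * d / t₄ →
      g * (b - a) * (t₁ * t₂ * t₃ * t₄) +
        k * t₀ * (c * (t₃ - t₁) * (t₂ * t₄) + d * (t₄ - t₂) * (t₁ * t₃)) = 0 := by
    intro t₀ t₁ t₂ t₃ t₄ h₀ h₁ h₂ h₃ h₄ h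
    field_simp at h
    linear_combination h
  linear_combination key _ _ _ _ _ hab hac had hbc hbd h

/-- The system is symmetric under p₁ ↔ p₂ and under p₃ ↔ p₄, so it can be written in symmetric
functions, and `hs` leaves only V, X and W. D is the product of the four mixed factors. The first
two relations come from the differences within each pair, the last from comparing the sums over the
two pairs. -/
theorem product_formula (hs : p₁ + p₂ + m * (p₃ + p₄) = 0)
    (h₁₂ : 1 + n * (p₁ * p₂) ≠ 0) (h₁₃ : 1 + n * (p₁ * p₃) ≠ 0) (h₁₄ : 1 + n * (p₁ * p₄) ≠ 0)
    (h₂₃ : 1 + n * (p₂ * p₃) ≠ 0) (h₂₄ : 1 + n * (p₂ * p₄) ≠ 0) (h₃₄ : 1 + n * (p₃ * p₄) ≠ 0)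
    (hne₁₂ : p₁ ≠ p₂) (hne₃₄ : p₃ ≠ p₄) (hw : p₃ + p₄ ≠ 0)
    (e₁ : p₂ / (1 + n * (p₁ * p₂)) + m * p₃ / (1 + n * (p₁ * p₃)) +
      m * p₄ / (1 + n * (p₁ * p₄)) = θ)
    (e₂ : p₁ / (1 + n * (p₁ * p₂)) + m * p₃ / (1 + n * (p₂ * p₃)) +
      m * p₄ / (1 + n * (p₂ * p₄)) = θ)
    (e₃ : p₁ / (1 + n * (p₁ * p₃)) + p₂ / (1 + n * (p₂ * p₃)) +
      m * p₄ / (1 + n * (p₃ * p₄)) = θ)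
    (e₄ : p₁ / (1 + n * (p₁ * p₄)) + p₂ / (1 + n * (p₂ * p₄)) +
      m * p₃ / (1 + n * (p₃ * p₄)) = θ) :
    ∃ V X W D : ℝ, V = n * (p₁ * p₂) ∧ X = n * (p₃ * p₄) ∧ W = n * (p₃ + p₄) ^ 2 ∧ D ≠ 0 ∧
      D = 1 - m * W + m ^ 2 * X * W - 2 * X * V + V * W - m * W * X * V + X ^ 2 * V ^ 2 ∧
      D + m * (1 + V) * (W - m * X * W + 2 * X * (V * X - 1)) = 0 ∧
      m * D + (1 + X) * (m ^ 2 * W - m * V * W + 2 * V * (V * X - 1)) = 0 ∧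
      (m * X - 1) * (V - m) = 0 := by
  have E₁₂ := pair_equation (g := 1) (k := m) hne₁₂ h₁₂ h₁₃ h₁₄ h₂₃ h₂₄
    (by simpa using e₁.trans e₂.symm)
  have E₃₄ := pair_equation (n := n) (g := m) (k := 1) hne₃₄ h₃₄
    (c := p₁) (d := p₂) (by rwa [mul_comm p₃]) (by rwa [mul_comm p₃]) (by rwa [mul_comm p₄])
    (by rwa [mul_comm p₄]) (by
      rw [mul_comm p₃ p₁, mul_comm p₃ p₂, mul_comm p₄ p₁, mul_comm p₄ p₂]
      linear_combination e₃ - e₄)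
  have hD : (1 + n * (p₁ * p₃)) * (1 + n * (p₁ * p₄)) * (1 + n * (p₂ * p₃)) *
      (1 + n * (p₂ * p₄)) ≠ 0 := by positivity
  have hp₁ : p₁ = -p₂ - m * (p₃ + p₄) := by linear_combination hs
  refine ⟨_, _, _, _, rfl, rfl, rfl, hD, ?_, ?_, ?_, ?_⟩
  · subst hp₁; ring
  · subst hp₁; linear_combination E₁₂
  · subst hp₁; linear_combination E₃₄
  · have key : (p₁ + p₂) * ((1 + n * (p₁ * p₃)) * (1 + n * (p₁ * p₄)) * (1 + n * (p₂ * p₃)) *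
        (1 + n * (p₂ * p₄)) / (1 + n * (p₁ * p₂))) +
        m * p₃ * ((1 + n * (p₁ * p₄)) * (1 + n * (p₂ * p₃)) * (1 + n * (p₂ * p₄))) +
        m * p₄ * ((1 + n * (p₁ * p₃)) * (1 + n * (p₂ * p₃)) * (1 + n * (p₂ * p₄))) +
        m * p₃ * ((1 + n * (p₁ * p₃)) * (1 + n * (p₁ * p₄)) * (1 + n * (p₂ * p₄))) +
        m * p₄ * ((1 + n * (p₁ * p₃)) * (1 + n * (p₁ * p₄)) * (1 + n * (p₂ * p₃))) =
        (p₃ + p₄) * (m * ((1 + n * (p₁ * p₃)) * (1 + n * (p₁ * p₄)) * (1 + n * (p₂ * p₃)) *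
        (1 + n * (p₂ * p₄))) / (1 + n * (p₃ * p₄))) +
        p₁ * ((1 + n * (p₁ * p₄)) * (1 + n * (p₂ * p₃)) * (1 + n * (p₂ * p₄))) +
        p₂ * ((1 + n * (p₁ * p₃)) * (1 + n * (p₁ * p₄)) * (1 + n * (p₂ * p₄))) +
        p₁ * ((1 + n * (p₁ * p₃)) * (1 + n * (p₂ * p₃)) * (1 + n * (p₂ * p₄))) +
        p₂ * ((1 + n * (p₁ * p₃)) * (1 + n * (p₁ * p₄)) * (1 + n * (p₂ * p₃))) := by
      have hE : p₂ / (1 + n * (p₁ * p₂)) + m * p₃ / (1 + n * (p₁ * p₃)) +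
        m * p₄ / (1 + n * (p₁ * p₄)) + (p₁ / (1 + n * (p₁ * p₂)) + m * p₃ / (1 + n * (p₂ * p₃)) +
        m * p₄ / (1 + n * (p₂ * p₄))) = p₁ / (1 + n * (p₁ * p₃)) + p₂ / (1 + n * (p₂ * p₃)) +
        m * p₄ / (1 + n * (p₃ * p₄)) + (p₁ / (1 + n * (p₁ * p₄)) + p₂ / (1 + n * (p₂ * p₄)) +
        m * p₃ / (1 + n * (p₃ * p₄))) := by rw [e₁, e₂, e₃, e₄]
      generalize 1 + n * (p₁ * p₂) = a at *
      generalize 1 + n * (p₁ * p₃) = b at *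
      generalize 1 + n * (p₁ * p₄) = c at *
      generalize 1 + n * (p₂ * p₃) = d at *
      generalize 1 + n * (p₂ * p₄) = e at *
      generalize 1 + n * (p₃ * p₄) = f at *
      field_simp
      field_simp at hE
      linear_combination hE
    have q₁ : (1 + n * (p₁ * p₃)) * (1 + n * (p₁ * p₄)) * (1 + n * (p₂ * p₃)) *
        (1 + n * (p₂ * p₄)) / (1 + n * (p₁ * p₂)) = -(m * n *
        (p₃ ^ 2 * ((1 + n * (p₁ * p₄)) * (1 + n * (p₂ * p₄))) +
        p₄ ^ 2 * ((1 + n * (p₁ * p₃)) * (1 + n * (p₂ * p₃))))) := by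
      rw [div_eq_iff h₁₂]; linear_combination E₁₂
    have q₂ : m * ((1 + n * (p₁ * p₃)) * (1 + n * (p₁ * p₄)) * (1 + n * (p₂ * p₃)) *
        (1 + n * (p₂ * p₄))) / (1 + n * (p₃ * p₄)) = -(n *
        (p₁ ^ 2 * ((1 + n * (p₃ * p₂)) * (1 + n * (p₄ * p₂))) +
        p₂ ^ 2 * ((1 + n * (p₃ * p₁)) * (1 + n * (p₄ * p₁))))) := by
      rw [div_eq_iff h₃₄]; linear_combination E₃₄
    -- The pair equations remove the denominators 1 + V and 1 + X. The two sides then differ by 4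
    -- (p₃ + p₄) (m X - 1) (V - m).
    rw [q₁, q₂] at key
    apply mul_left_cancel₀ hw
    subst hp₁
    linear_combination key / 4

theorem product_values (hm₀ : m ≠ 0) (hm₁ : -1 < m) (hm₂ : m < 1)
    (hs : p₁ + p₂ + m * (p₃ + p₄) = 0)
    (h₁₂ : 1 + n * (p₁ * p₂) ≠ 0) (h₁₃ : 1 + n * (p₁ * p₃) ≠ 0) (h₁₄ : 1 + n * (p₁ * p₄) ≠ 0)
    (h₂₃ : 1 + n * (p₂ * p₃) ≠ 0) (h₂₄ : 1 + n * (p₂ * p₄) ≠ 0) (h₃₄ : 1 + n * (p₃ * p₄) ≠ 0)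
    (hne₁₂ : p₁ ≠ p₂) (hne₃₄ : p₃ ≠ p₄) (hw : p₃ + p₄ ≠ 0)
    (e₁ : p₂ / (1 + n * (p₁ * p₂)) + m * p₃ / (1 + n * (p₁ * p₃)) +
      m * p₄ / (1 + n * (p₁ * p₄)) = θ)
    (e₂ : p₁ / (1 + n * (p₁ * p₂)) + m * p₃ / (1 + n * (p₂ * p₃)) +
      m * p₄ / (1 + n * (p₂ * p₄)) = θ)
    (e₃ : p₁ / (1 + n * (p₁ * p₃)) + p₂ / (1 + n * (p₂ * p₃)) +
      m * p₄ / (1 + n * (p₃ * p₄)) = θ)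
    (e₄ : p₁ / (1 + n * (p₁ * p₄)) + p₂ / (1 + n * (p₂ * p₄)) +
      m * p₃ / (1 + n * (p₃ * p₄)) = θ) :
    n * (p₁ * p₂) = m ∧ (m + 2) * (n * (p₃ * p₄)) = -1 ∧
      m * (m + 2) * (n * (p₃ + p₄) ^ 2) = -2 * (m + 1) := by
  obtain ⟨V, X, W, D, hV, hX, hW, hD, hDe, E₁₂, E₃₄, E⟩ := product_formula hs h₁₂ h₁₃ h₁₄ h₂₃ h₂₄
    h₃₄ hne₁₂ hne₃₄ hw e₁ e₂ e₃ e₄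
  rw [← hV, ← hX, ← hW]
  by_cases hVm : V = m
  · have hD' : D = (1 - m * X) ^ 2 := by rw [hDe, hVm]; ring
    have h1 : 1 - m * X ≠ 0 := fun h => hD (by rw [hD', h]; ring)
    have hX' : (m + 2) * X = -1 := by
      apply mul_left_cancel₀ h1
      apply mul_left_cancel₀ hm₀
      rw [hD', hVm] at E₃₄
      linear_combination -E₃₄
    have hW' : (1 - m * X) + m * (1 + m) * (W - 2 * X) = 0 := by
      apply mul_left_cancel₀ h1
      rw [hD', hVm] at E₁₂
      linear_combination E₁₂
    refine ⟨hVm, hX', ?_⟩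
    have h2 : m + 1 ≠ 0 := by linarith
    apply mul_left_cancel₀ h2
    linear_combination (m + 2) * hW' + (m + 2 * m * (m + 1)) * hX'
  · exfalso
    have hX' : m * X = 1 := by
      rcases mul_eq_zero.1 E with h | h
      · linarith
      · exact absurd (by linarith) hVm
    have hD' : m ^ 2 * D = (m - V) ^ 2 := by
      rw [hDe]
      linear_combination (m ^ 3 * W - 2 * m * V - m ^ 2 * V * W + (m * X + 1) * V ^ 2) * hX'
    have h1 : m - V ≠ 0 := sub_ne_zero.2 (Ne.symm hVm)
    have hV' : (1 + 2 * m) * V = -m := by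
      apply mul_left_cancel₀ h1
      linear_combination -m ^ 2 * E₁₂ + hD' + (-m ^ 3 * (1 + V) * W +
        2 * m * (1 + V) * (V * (m * X + 1) - m)) * hX'
    have h4 : m * (m - V) + m ^ 2 * (m + 1) * W - 2 * (m + 1) * V = 0 := by
      apply mul_left_cancel₀ h1
      linear_combination m ^ 2 * E₃₄ - m * hD' -
        (m ^ 2 * W * (m - V) + 2 * V * (V * (m * X + 1) + m * V - m)) * hX'
    have hW' : m * (1 + 2 * m) * W = -2 * (m + 1) := by
      have h5 : m * (m + 1) ≠ 0 := mul_ne_zero hm₀ (by linarith)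
      apply mul_left_cancel₀ h5
      linear_combination (1 + 2 * m) * h4 + (3 * m + 2) * hV'
    -- By `hs`, (p₁ - p₂)² = m² (p₃ + p₄)² - 4 p₁p₂. Multiplied by n² (p₃ + p₄)² this is W (m² W -
    -- 4V), which the values just found make negative; here m < 1 enters.
    have h2 : (m * (1 + 2 * m)) ^ 2 * (W * (m ^ 2 * W - 4 * V)) < 0 := by
      have : (m * (1 + 2 * m)) ^ 2 * (W * (m ^ 2 * W - 4 * V)) =
          -(4 * m ^ 2 * ((1 + m) * (1 - m))) := by
        linear_combination (m ^ 2 * (m * (1 + 2 * m) * W) - 2 * m ^ 2 * (m + 1) -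
          4 * m * (1 + 2 * m) * V) * hW' + 8 * m * (m + 1) * hV'
      rw [this]
      have : 0 < m ^ 2 * ((1 + m) * (1 - m)) := by
        have := sub_pos.2 hm₂
        have : 0 < 1 + m := by linarith
        positivity
      linarith
    have h3 : W * (m ^ 2 * W - 4 * V) = (n * (p₃ + p₄) * (p₁ - p₂)) ^ 2 := by
      rw [hW, hV]
      linear_combination (-n ^ 2 * (p₃ + p₄) ^ 2 * (p₁ + p₂ - m * (p₃ + p₄))) * hs
    rw [h3, ← mul_pow] at h2
    exact absurd h2 (not_lt.2 (sq_nonneg _))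

end Algebra
-- Affine dependencies and signed areas.
section Dependency

/-- Twice the signed area of the triangle `a b c`. -/
def cross (a b c : ℂ) : ℝ :=
  (b.re - a.re) * (c.im - a.im) - (b.im - a.im) * (c.re - a.re)

/-- The signed areas of the four triangles of a configuration: the coefficients of its affine
dependency. -/
def areaVector (x : Fin 4 → ℂ) : Fin 4 → ℝ :=
  ![cross (x 1) (x 2) (x 3), -cross (x 0) (x 2) (x 3), cross (x 0) (x 1) (x 3),
    -cross (x 0) (x 1) (x 2)]

/-- The numbers `D i` are the coefficients of an affine dependency of the points `x i`. -/
def IsDependency {n : ℕ} (D : Fin n → ℝ) (x : Fin n → ℂ) : Prop :=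
  ∑ i, D i = 0 ∧ ∑ i, D i • x i = 0

theorem isDependency_iff {D : Fin 4 → ℝ} {x : Fin 4 → ℂ} :
    IsDependency D x ↔ D 0 + D 1 + D 2 + D 3 = 0 ∧
      D 0 * (x 0).re + D 1 * (x 1).re + D 2 * (x 2).re + D 3 * (x 3).re = 0 ∧
      D 0 * (x 0).im + D 1 * (x 1).im + D 2 * (x 2).im + D 3 * (x 3).im = 0 := by
  simp [IsDependency, Fin.sum_univ_four, Complex.ext_iff]

theorem isDependency_areaVector (x : Fin 4 → ℂ) : IsDependency (areaVector x) x := by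
  rw [isDependency_iff]
  simp only [areaVector, cross, Matrix.cons_val]
  refine ⟨?_, ?_, ?_⟩ <;> ring

/-- Uniqueness of the dependency up to scale, in a form that avoids division and needs no planarity.
-/
theorem IsDependency.mul_areaVector {D : Fin 4 → ℝ} {x : Fin 4 → ℂ} (h : IsDependency D x)
    (i j : Fin 4) : D i * areaVector x j = D j * areaVector x i := by
  obtain ⟨h₁, h₂, h₃⟩ := isDependency_iff.1 h
  have h₀ : D 0 = -(D 1 + D 2 + D 3) := by linear_combination h₁
  -- Pairing the vector relation with a normal to the side joining two of the points leaves only the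
  -- coefficients of the other two.
  have key : ∀ r s : ℝ, r * (D 0 * (x 0).re + D 1 * (x 1).re + D 2 * (x 2).re + D 3 * (x 3).re) +
      s * (D 0 * (x 0).im + D 1 * (x 1).im + D 2 * (x 2).im + D 3 * (x 3).im) = 0 := by
    intro r s
    rw [h₂, h₃]; ring
  rw [h₀] at key
  have h01 : D 0 * areaVector x 1 = D 1 * areaVector x 0 := by
    simp only [areaVector, cross, Matrix.cons_val, h₀]
    linear_combination -key ((x 2).im - (x 3).im) ((x 3).re - (x 2).re)
  have h02 : D 0 * areaVector x 2 = D 2 * areaVector x 0 := by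
    simp only [areaVector, cross, Matrix.cons_val, h₀]
    linear_combination -key ((x 3).im - (x 1).im) ((x 1).re - (x 3).re)
  have h03 : D 0 * areaVector x 3 = D 3 * areaVector x 0 := by
    simp only [areaVector, cross, Matrix.cons_val, h₀]
    linear_combination -key ((x 1).im - (x 2).im) ((x 2).re - (x 1).re)
  have h12 : D 1 * areaVector x 2 = D 2 * areaVector x 1 := by
    simp only [areaVector, cross, Matrix.cons_val]
    linear_combination -key ((x 0).im - (x 3).im) ((x 3).re - (x 0).re)
  have h13 : D 1 * areaVector x 3 = D 3 * areaVector x 1 := by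
    simp only [areaVector, cross, Matrix.cons_val]
    linear_combination -key ((x 2).im - (x 0).im) ((x 0).re - (x 2).re)
  have h23 : D 2 * areaVector x 3 = D 3 * areaVector x 2 := by
    simp only [areaVector, cross, Matrix.cons_val]
    linear_combination -key ((x 0).im - (x 1).im) ((x 1).re - (x 0).re)
  fin_cases i <;> fin_cases j <;> first | rfl | assumption | (symm; assumption)

theorem collinear_triple_iff {a b c : ℂ} : Collinear ℝ {a, b, c} ↔ cross a b c = 0 := by
  constructor
  · intro h
    obtain ⟨v, hv⟩ := (collinear_iff_of_mem (p₀ := a) (by simp)).1 h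
    obtain ⟨r, hr⟩ := hv b (by simp)
    obtain ⟨s, hs⟩ := hv c (by simp)
    subst hr hs
    simp [cross]; ring
  · intro h
    by_cases hab : a = b
    · subst hab
      simpa using collinear_pair ℝ a c
    · rw [collinear_iff_of_mem (p₀ := a) (by simp)]
      refine ⟨b - a, ?_⟩
      simp only [Set.mem_insert_iff, Set.mem_singleton_iff]
      have hN : Complex.normSq (b - a) ≠ 0 := by
        rw [Ne, Complex.normSq_eq_zero, sub_eq_zero]; exact fun h => hab h.symm
      rintro p (rfl | rfl | rfl)
      · exact ⟨0, by simp⟩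
      · exact ⟨1, by simp⟩
      · obtain ⟨r, h₁, h₂⟩ : ∃ r : ℝ, p.re = r * (b.re - a.re) + a.re ∧
            p.im = r * (b.im - a.im) + a.im := by
          simp only [Complex.normSq_apply, Complex.sub_re, Complex.sub_im, ← sq] at hN
          simp only [cross] at h
          refine ⟨((b.re - a.re) * (p.re - a.re) + (b.im - a.im) * (p.im - a.im)) /
            ((b.re - a.re) ^ 2 + (b.im - a.im) ^ 2), ?_, ?_⟩
          · field_simp
            linear_combination (-(b.im - a.im)) * h
          · field_simp
            linear_combination (b.re - a.re) * h
        exact ⟨r, Complex.ext (by simpa using h₁) (by simpa using h₂)⟩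

theorem isStrictlyPlanar_iff {x : Fin 4 → ℂ} (hx : Function.Injective x) :
    IsStrictlyPlanar x ↔ ∃ i, areaVector x i ≠ 0 := by
  rw [IsStrictlyPlanar, not_iff_comm]
  push Not
  constructor
  · intro h
    have h₂ : cross (x 0) (x 1) (x 2) = 0 := by simpa [areaVector] using h 3
    have h₃ : cross (x 0) (x 1) (x 3) = 0 := by simpa [areaVector] using h 2
    have h01 : x 0 ≠ x 1 := hx.ne (by decide)
    have c₂ := collinear_triple_iff.2 h₂
    have c₃ := collinear_triple_iff.2 h₃
    refine (collinear_insert_insert_of_mem_affineSpan_pair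
      (c₂.mem_affineSpan_of_mem_of_ne (p₃ := x 2) (by simp) (by simp) (by simp) h01)
      (c₃.mem_affineSpan_of_mem_of_ne (p₃ := x 3) (by simp) (by simp) (by simp) h01)).subset ?_
    rintro _ ⟨i, rfl⟩
    fin_cases i <;> simp
  · intro h i
    have key : ∀ a b c, cross (x a) (x b) (x c) = 0 := fun a b c =>
      collinear_triple_iff.1 (h.subset (by
        intro p; simp only [Set.mem_insert_iff, Set.mem_singleton_iff]
        rintro (rfl | rfl | rfl) <;> exact Set.mem_range_self _))
    fin_cases i <;> simp [areaVector, key]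

theorem hasCollinearTriple_iff {x : Fin 4 → ℂ} :
    HasCollinearTriple x ↔ ∃ i, areaVector x i = 0 := by
  constructor
  · rintro ⟨i, j, k, hij, hik, hjk, h⟩
    rw [collinear_triple_iff] at h
    revert h
    simp only [areaVector, cross]
    fin_cases i <;> fin_cases j <;> first | exact absurd rfl hij | skip
    all_goals fin_cases k <;> first | exact absurd rfl hik | exact absurd rfl hjk | skip
    all_goals
      intro h
      simp only [Fin.zero_eta, Fin.mk_one, Fin.reduceFinMk] at h
      first
      | exact ⟨0, by simp only [Matrix.cons_val]; linarith⟩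
      | exact ⟨1, by simp only [Matrix.cons_val]; linarith⟩
      | exact ⟨2, by simp only [Matrix.cons_val]; linarith⟩
      | exact ⟨3, by simp only [Matrix.cons_val]; linarith⟩
  · rintro ⟨i, hi⟩
    fin_cases i
    · exact ⟨1, 2, 3, by decide, by decide, by decide,
        collinear_triple_iff.2 (by simpa [areaVector] using hi)⟩
    · exact ⟨0, 2, 3, by decide, by decide, by decide,
        collinear_triple_iff.2 (by simpa [areaVector] using hi)⟩
    · exact ⟨0, 1, 3, by decide, by decide, by decide,
        collinear_triple_iff.2 (by simpa [areaVector] using hi)⟩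
    · exact ⟨0, 1, 2, by decide, by decide, by decide,
        collinear_triple_iff.2 (by simpa [areaVector] using hi)⟩

end Dependency

/-! ### Eliminating the centre of rotation. -/

section Reduction

/-- The weighted forces cancel in pairs, so `c` is forced to be the centre of vorticity.
Substituting it absorbs the linear term into the sum, with l = ω / ∑ Γ. -/
theorem isRelativeEquilibrium_iff {n : ℕ} {Γ : Fin n → ℝ} (hΓ : ∑ i, Γ i ≠ 0) {x : Fin n → ℂ} :
    IsRelativeEquilibrium Γ x ↔ Function.Injective x ∧ ∃ l : ℝ, l ≠ 0 ∧
      ∀ i, ∑ j, (Γ j * ((‖x i - x j‖ ^ 2)⁻¹ - l)) • (x i - x j) = 0 := by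
  have hF : ∀ i, ∑ j ∈ Finset.univ.erase i, (Γ j / ‖x i - x j‖ ^ 2) • (x j - x i) =
      ∑ j, (Γ j / ‖x i - x j‖ ^ 2) • (x j - x i) := fun i =>
    Finset.sum_erase _ (by simp)
  have hsplit : ∀ (l : ℝ) i, ∑ j, (Γ j * ((‖x i - x j‖ ^ 2)⁻¹ - l)) • (x i - x j) =
      -∑ j, (Γ j / ‖x i - x j‖ ^ 2) • (x j - x i) -
        l • ((∑ j, Γ j) • x i - ∑ j, Γ j • x j) := by
    intro l i
    rw [Finset.sum_smul, ← Finset.sum_sub_distrib, Finset.smul_sum, ← Finset.sum_neg_distrib,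
      ← Finset.sum_sub_distrib]
    refine Finset.sum_congr rfl fun j _ => ?_
    simp only [Complex.real_smul]
    push_cast
    ring
  constructor
  · rintro ⟨hx, ω, hω, c, h⟩
    refine ⟨hx, ω / ∑ j, Γ j, div_ne_zero hω hΓ, fun i => ?_⟩
    have hanti : ∑ i, Γ i • ∑ j, (Γ j / ‖x i - x j‖ ^ 2) • (x j - x i) = 0 := by
      have h1 : ∑ i, Γ i • ∑ j, (Γ j / ‖x i - x j‖ ^ 2) • (x j - x i) =
          -∑ i, Γ i • ∑ j, (Γ j / ‖x i - x j‖ ^ 2) • (x j - x i) := by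
        simp only [Finset.smul_sum]
        conv_rhs => rw [Finset.sum_comm]
        rw [← Finset.sum_neg_distrib]
        refine Finset.sum_congr rfl fun i _ => ?_
        rw [← Finset.sum_neg_distrib]
        refine Finset.sum_congr rfl fun j _ => ?_
        rw [norm_sub_rev (x j)]
        simp only [Complex.real_smul]
        push_cast
        ring
      exact self_eq_neg.1 h1
    have hc : ∑ j, Γ j • x j = (∑ j, Γ j) • c := by
      simp only [← hF, ← h] at hanti
      have h2 : ω • (∑ j, Γ j • x j - (∑ j, Γ j) • c) = 0 := by
        rw [← neg_eq_zero, ← hanti, Finset.sum_smul, ← Finset.sum_sub_distrib, Finset.smul_sum,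
          ← Finset.sum_neg_distrib]
        refine Finset.sum_congr rfl fun j _ => ?_
        simp only [Complex.real_smul]
        ring
      exact sub_eq_zero.1 ((smul_eq_zero.1 h2).resolve_left hω)
    rw [hsplit, hc, ← hF, ← h, ← smul_sub, smul_smul, div_mul_cancel₀ _ hΓ]
    simp
  · rintro ⟨hx, l, hl, h⟩
    refine ⟨hx, l * ∑ j, Γ j, mul_ne_zero hl hΓ, (∑ j, Γ j)⁻¹ • ∑ j, Γ j • x j, fun i => ?_⟩
    have := h i
    rw [hsplit] at this
    rw [hF, mul_smul, smul_sub (∑ j, Γ j), smul_inv_smul₀ hΓ]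
    linear_combination this

theorem sum_strength (m : ℝ) : ∑ i, strength m i = 2 * (m + 1) := by
  simp [Fin.sum_univ_four, strength]; ring

end Reduction
-- Criteria for the presence and absence of a line of symmetry.
section Symmetry

/-- The reflection in the perpendicular bisector of `a` and `b`. -/
theorem exists_lineReflection {a b : ℂ} (hab : a ≠ b) :
    ∃ p u : ℂ, ‖u‖ = 1 ∧ ∀ z w : ℂ,
      (z.re - w.re) * (a.im - b.im) = (z.im - w.im) * (a.re - b.re) →
      (z.re + w.re - (a.re + b.re)) * (a.re - b.re) +
        (z.im + w.im - (a.im + b.im)) * (a.im - b.im) = 0 →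
      lineReflection p u z = w := by
  have hn : (‖a - b‖ : ℂ) ≠ 0 := by simpa [sub_eq_zero] using hab
  have hd : (starRingEnd ℂ) (a - b) ≠ 0 :=
    (map_ne_zero _).2 (sub_ne_zero.2 hab)
  refine ⟨(1 / 2 : ℝ) • (a + b), Complex.I * (a - b) / ‖a - b‖, ?_, fun z w h₁ h₂ => ?_⟩
  · have : ‖a - b‖ ≠ 0 := by simpa [sub_eq_zero] using hab
    simp [this]
  · have hu : (Complex.I * (a - b) / ‖a - b‖) ^ 2 * (starRingEnd ℂ) (a - b) = -(a - b) := by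
      have h := Complex.mul_conj' (a - b)
      rw [div_pow, mul_pow, Complex.I_sq, ← h]
      have : a - b ≠ 0 := sub_ne_zero.2 hab
      field_simp
    have key : (w - (1 / 2 : ℝ) • (a + b)) * (starRingEnd ℂ) (a - b) =
        -((a - b) * (starRingEnd ℂ) (z - (1 / 2 : ℝ) • (a + b))) := by
      apply Complex.ext
      · simp only [Complex.mul_re, Complex.neg_re, Complex.conj_re, Complex.conj_im, Complex.sub_re,
          Complex.sub_im, Complex.smul_re, Complex.smul_im, Complex.add_re, Complex.add_im,
          smul_eq_mul]
        linear_combination h₂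
      · simp only [Complex.mul_im, Complex.neg_im, Complex.conj_re, Complex.conj_im, Complex.sub_re,
          Complex.sub_im, Complex.smul_re, Complex.smul_im, Complex.add_re, Complex.add_im,
          smul_eq_mul]
        linear_combination h₁
    rw [lineReflection, ← sub_eq_zero]
    apply mul_right_cancel₀ hd
    linear_combination (starRingEnd ℂ) (z - (1 / 2 : ℝ) • (a + b)) * hu - key

theorem hasLineOfSymmetry_of_perm {n : ℕ} {x : Fin n → ℂ} {p u : ℂ} (hu : ‖u‖ = 1)
    (σ : Equiv.Perm (Fin n)) (h : ∀ i, lineReflection p u (x i) = x (σ i)) :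
    HasLineOfSymmetry x := by
  refine ⟨p, u, hu, ?_⟩
  rw [← Set.range_comp, show lineReflection p u ∘ x = x ∘ σ from funext h]
  exact σ.surjective.range_comp x

theorem sq_norm_sub (a b : ℂ) : ‖a - b‖ ^ 2 = (a.re - b.re) ^ 2 + (a.im - b.im) ^ 2 := by
  rw [Complex.sq_norm, Complex.normSq_apply, Complex.sub_re, Complex.sub_im]; ring

theorem hasLineOfSymmetry_of_equidistant {n : ℕ} {x : Fin n → ℂ} {i j : Fin n} (hij : x i ≠ x j)
    (h : ∀ k, k ≠ i → k ≠ j → ‖x i - x k‖ ^ 2 = ‖x j - x k‖ ^ 2) : HasLineOfSymmetry x := by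
  obtain ⟨p, u, hu, H⟩ := exists_lineReflection hij
  refine hasLineOfSymmetry_of_perm (p := p) hu (Equiv.swap i j) fun k => ?_
  by_cases hki : k = i
  · subst hki
    rw [Equiv.swap_apply_left]
    exact H _ _ (by ring) (by ring)
  by_cases hkj : k = j
  · subst hkj
    rw [Equiv.swap_apply_right]
    exact H _ _ (by ring) (by ring)
  rw [Equiv.swap_apply_of_ne_of_ne hki hkj]
  have := h k hki hkj
  rw [sq_norm_sub, sq_norm_sub] at this
  exact H _ _ (by ring) (by linear_combination -this)

/-- An isosceles trapezoid has a line of symmetry. -/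
theorem hasLineOfSymmetry_of_trapezoid {x : Fin 4 → ℂ} (h01 : x 0 ≠ x 1)
    (hp : ((x 2).re - (x 3).re) * ((x 0).im - (x 1).im) =
      ((x 2).im - (x 3).im) * ((x 0).re - (x 1).re))
    (h₁ : ‖x 0 - x 2‖ ^ 2 = ‖x 1 - x 3‖ ^ 2) (h₂ : ‖x 0 - x 3‖ ^ 2 = ‖x 1 - x 2‖ ^ 2) :
    HasLineOfSymmetry x := by
  obtain ⟨p, u, hu, H⟩ := exists_lineReflection h01
  rw [sq_norm_sub, sq_norm_sub] at h₁ h₂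
  refine hasLineOfSymmetry_of_perm (p := p) hu (Equiv.swap 0 1 * Equiv.swap 2 3) fun k => ?_
  fin_cases k
  · exact H (x 0) (x 1) (by ring) (by ring)
  · exact H (x 1) (x 0) (by ring) (by ring)
  · exact H (x 2) (x 3) hp (by linear_combination -(h₁ + h₂) / 2)
  · exact H (x 3) (x 2) (by linear_combination -hp) (by linear_combination -(h₁ + h₂) / 2)

theorem lineReflection_injective (p : ℂ) {u : ℂ} (hu : ‖u‖ = 1) :
    Function.Injective (lineReflection p u) := by
  intro z w h
  have hu0 : u ^ 2 ≠ 0 := pow_ne_zero _ fun h0 => by simp [h0] at hu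
  have h' := mul_left_cancel₀ hu0 (add_left_cancel h)
  exact sub_left_injective ((starRingEnd ℂ).injective h')

theorem IsDependency.lineReflection {n : ℕ} {D : Fin n → ℝ} {x : Fin n → ℂ}
    (h : IsDependency D x) (p u : ℂ) : IsDependency D (fun i => lineReflection p u (x i)) := by
  refine ⟨h.1, ?_⟩
  have h₁ : ∑ i, (D i : ℂ) = 0 := by exact_mod_cast h.1
  have h₂ : ∑ i, (D i : ℂ) * (starRingEnd ℂ) (x i) = 0 := by
    have := congrArg (starRingEnd ℂ) h.2
    simpa [Complex.real_smul] using this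
  have : ∀ i, D i • FourVortex.lineReflection p u (x i) =
      D i * (p - u ^ 2 * (starRingEnd ℂ) p) + u ^ 2 * (D i * (starRingEnd ℂ) (x i)) := by
    intro i
    simp only [Complex.real_smul, FourVortex.lineReflection, map_sub]
    ring
  simp only [this, Finset.sum_add_distrib, ← Finset.sum_mul, ← Finset.mul_sum, h₁, h₂]
  simp

theorem IsDependency.eq_smul_areaVector {D : Fin 4 → ℝ} {x : Fin 4 → ℂ} (h : IsDependency D x)
    (hx : ∃ i, areaVector x i ≠ 0) : ∃ c : ℝ, ∀ i, D i = c * areaVector x i := by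
  obtain ⟨j, hj⟩ := hx
  refine ⟨D j / areaVector x j, fun i => ?_⟩
  have := h.mul_areaVector i j
  field_simp
  linear_combination this

/-- A symmetry permutes the labels and turns D into another dependency, hence a multiple of D.
Distinct squares force the permutation to be trivial, so all points lie on the axis. -/
theorem not_hasLineOfSymmetry {x : Fin 4 → ℂ} (hinj : Function.Injective x)
    (hx : IsStrictlyPlanar x) {D : Fin 4 → ℝ} (hD : IsDependency D x)
    (hsq : Function.Injective fun i => D i ^ 2) : ¬ HasLineOfSymmetry x := by
  rintro ⟨p, u, hu, himg⟩
  have hex : ∀ i, ∃ j, x j = lineReflection p u (x i) := fun i => by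
    have : lineReflection p u (x i) ∈ Set.range x := by
      rw [← himg]; exact ⟨_, Set.mem_range_self i, rfl⟩
    exact this
  choose f hf using hex
  have hfinj : Function.Injective f := fun i j hij => by
    apply hinj
    apply lineReflection_injective p hu
    rw [← hf, ← hf, hij]
  let σ := Equiv.ofBijective f (Finite.injective_iff_bijective.1 hfinj)
  have hσ : ∀ i, lineReflection p u (x i) = x (σ i) := fun i => (hf i).symm
  have hE : IsDependency (fun i => D (σ.symm i)) x := by
    have h := hD.lineReflection p u
    simp only [hσ] at h
    refine ⟨?_, ?_⟩
    · rw [Equiv.sum_comp σ.symm D]; exact h.1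
    · rw [← h.2, ← Equiv.sum_comp σ]
      simp
  have hA := (isStrictlyPlanar_iff hinj).1 hx
  obtain ⟨c, hc⟩ := hD.eq_smul_areaVector hA
  obtain ⟨d, hd⟩ := hE.eq_smul_areaVector hA
  -- A permutation preserves the sum of the squared coefficients, so the factor between the two
  -- dependencies is ±1.
  have hsum : d ^ 2 = c ^ 2 := by
    have h1 : ∑ i, (D (σ.symm i)) ^ 2 = ∑ i, D i ^ 2 := Equiv.sum_comp σ.symm fun i => D i ^ 2
    simp only [hc, mul_pow, ← Finset.mul_sum] at h1
    have h2 : ∑ i, D (σ.symm i) ^ 2 = d ^ 2 * ∑ i, areaVector x i ^ 2 := by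
      rw [Finset.mul_sum]
      exact Finset.sum_congr rfl fun i _ => by rw [hd i, mul_pow]
    simp only [hc, mul_pow, ← Finset.mul_sum] at h2
    rw [h1] at h2
    obtain ⟨i, hi⟩ := hA
    have : ∑ i, areaVector x i ^ 2 ≠ 0 := by
      refine ne_of_gt (Finset.sum_pos' (fun _ _ => sq_nonneg _) ⟨i, Finset.mem_univ _, ?_⟩)
      positivity
    exact (mul_right_cancel₀ this h2).symm
  have hid : ∀ i, σ i = i := fun i => by
    have : D (σ.symm (σ i)) ^ 2 = D (σ i) ^ 2 := by
      rw [hd, hc, mul_pow, mul_pow, hsum]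
    rw [Equiv.symm_apply_apply] at this
    exact (hsq this).symm
  apply hx
  rw [collinear_iff_exists_forall_eq_smul_vadd]
  refine ⟨p, u, ?_⟩
  rintro _ ⟨i, rfl⟩
  have hfix := hσ i
  rw [hid, lineReflection] at hfix
  have huu : u * (starRingEnd ℂ) u = 1 := by
    rw [Complex.mul_conj', hu]; simp
  -- A point fixed by the reflection has `(x i - p) * conj u` real, which is its coordinate along
  -- the axis.
  obtain ⟨r, hr⟩ := Complex.conj_eq_iff_real.1
    (show (starRingEnd ℂ) ((x i - p) * (starRingEnd ℂ) u) = (x i - p) * (starRingEnd ℂ) u by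
      rw [map_mul, Complex.conj_conj]
      linear_combination (starRingEnd ℂ) u * hfix - u * (starRingEnd ℂ) (x i - p) * huu)
  refine ⟨r, ?_⟩
  rw [vadd_eq_add, Complex.real_smul, ← hr]
  linear_combination -(x i - p) * huu

end Symmetry

/-! ### Convexity and concavity from the signs of the areas. -/

section Convexity

/-- The weights are indexed by all labels, with zero at `i`, so that they can be compared with an
affine dependency. -/
theorem exists_weights_of_mem_convexHull {n : ℕ} {x : Fin n → ℂ} {i : Fin n} {p : ℂ}
    (h : p ∈ convexHull ℝ (x '' {i}ᶜ)) :
    ∃ w : Fin n → ℝ, w i = 0 ∧ (∀ j, 0 ≤ w j) ∧ ∑ j, w j = 1 ∧ ∑ j, w j • x j = p := by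
  refine mem_convexHull_iff.1 h
    {p | ∃ w : Fin n → ℝ, w i = 0 ∧ (∀ j, 0 ≤ w j) ∧ ∑ j, w j = 1 ∧ ∑ j, w j • x j = p} ?_ ?_
  · rintro _ ⟨j, hj, rfl⟩
    refine ⟨Pi.single j 1, ?_, fun k => ?_, ?_, ?_⟩
    · exact Pi.single_eq_of_ne (fun h => hj h.symm) _
    · by_cases hk : k = j
      · subst hk; simp
      · rw [Pi.single_eq_of_ne hk]
    · simp
    · simp [Pi.single_apply]
  · rintro _ ⟨w, hw₀, hw₁, hw₂, rfl⟩ _ ⟨v, hv₀, hv₁, hv₂, rfl⟩ a b ha hb hab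
    refine ⟨fun j => a * w j + b * v j, by simp [hw₀, hv₀], fun j => ?_, ?_, ?_⟩
    · have := hw₁ j
      have := hv₁ j
      positivity
    · rw [Finset.sum_add_distrib, ← Finset.mul_sum, ← Finset.mul_sum, hw₂, hv₂]; simpa using hab
    · simp only [add_smul, Finset.sum_add_distrib, mul_smul, ← Finset.smul_sum]

/-- A point in the hull of the others would give a dependency with -1 at `i` and nonnegative entries
elsewhere, so no other area could share the sign of the `i`-th. -/
theorem isConvex_of_areaVector {x : Fin 4 → ℂ} (h₀ : ∀ i, areaVector x i ≠ 0)
    (h : ∀ i, ∃ j, j ≠ i ∧ 0 < areaVector x j * areaVector x i) : IsConvex x := by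
  refine ⟨fun hc => ?_, fun i hi => ?_⟩
  · obtain ⟨i, hi⟩ := hasCollinearTriple_iff.1 hc
    exact h₀ i hi
  · obtain ⟨w, hw₀, hw₁, hw₂, hw₃⟩ := exists_weights_of_mem_convexHull hi
    have hE : IsDependency (fun j => w j - Pi.single (M := fun _ => ℝ) i 1 j) x := by
      refine ⟨by simp [hw₂], ?_⟩
      simp only [sub_smul, Finset.sum_sub_distrib, hw₃]
      simp [Pi.single_apply]
    obtain ⟨j, hji, hj⟩ := h i
    have := hE.mul_areaVector i j
    simp only [hw₀, Pi.single_eq_same, Pi.single_eq_of_ne hji, sub_zero] at this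
    have h2 : areaVector x j * areaVector x i = -(w j * areaVector x i ^ 2) := by
      linear_combination -areaVector x i * this
    have := mul_nonneg (hw₁ j) (sq_nonneg (areaVector x i))
    linarith

theorem mem_interior_convexHull_triangle {a b c : ℂ} (h : cross a b c ≠ 0) {r s t : ℝ}
    (hr : 0 < r) (hs : 0 < s) (ht : 0 < t) (hsum : r + s + t = 1) :
    r • a + s • b + t • c ∈ interior (convexHull ℝ {a, b, c}) := by
  have hind : AffineIndependent ℝ ![a, b, c] :=
    affineIndependent_iff_not_collinear_set.2 (mt collinear_triple_iff.1 h)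
  let B : AffineBasis (Fin 3) ℝ ℂ := ⟨![a, b, c], hind, by
    rw [hind.affineSpan_eq_top_iff_card_eq_finrank_add_one]
    simp⟩
  have hB : Set.range B = {a, b, c} := by
    change Set.range ![a, b, c] = _
    ext z
    simp [eq_comm]
    tauto
  have hp : r • a + s • b + t • c = Finset.univ.affineCombination ℝ B ![r, s, t] := by
    rw [Finset.affineCombination_eq_linear_combination _ _ _ (by simp [Fin.sum_univ_three, hsum])]
    simp only [Fin.sum_univ_three]
    rfl
  rw [← hB, B.interior_convexHull, hp]
  intro i
  rw [B.coord_apply_combination_of_mem (Finset.mem_univ i) (by simp [Fin.sum_univ_three, hsum])]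
  fin_cases i
  · exact hr
  · exact hs
  · exact ht

/-- If the `i`-th area alone has its sign, the quotients -Δ j / Δ i are positive barycentric
coordinates of `x i`. -/
theorem isConcave_of_areaVector {x : Fin 4 → ℂ} (h₀ : ∀ i, areaVector x i ≠ 0) {i : Fin 4}
    (h : ∀ j, j ≠ i → areaVector x j * areaVector x i < 0) : IsConcave x := by
  refine ⟨fun hc => ?_, i, ?_⟩
  · obtain ⟨i, hi⟩ := hasCollinearTriple_iff.1 hc
    exact h₀ i hi
  · have hpos : ∀ j, j ≠ i → 0 < -areaVector x j / areaVector x i := fun j hj => by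
      have h1 := h j hj
      have h2 := h₀ i
      rw [show -areaVector x j / areaVector x i =
        -(areaVector x j * areaVector x i) / areaVector x i ^ 2 by field_simp]
      have : 0 < -(areaVector x j * areaVector x i) := by linarith
      positivity
    obtain ⟨e₁, e₂⟩ := isDependency_areaVector x
    simp only [Fin.sum_univ_four] at e₁ e₂
    have hcompl : ∀ a b c : Fin 4, ({i}ᶜ : Set (Fin 4)) = {a, b, c} →
        x '' {i}ᶜ = {x a, x b, x c} := fun a b c h => by
      rw [h]; simp [Set.image_insert_eq]
    have main : ∀ a b c : Fin 4, ({i}ᶜ : Set (Fin 4)) = {a, b, c} → cross (x a) (x b) (x c) ≠ 0 →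
        areaVector x a + areaVector x b + areaVector x c + areaVector x i = 0 →
        areaVector x a • x a + areaVector x b • x b + areaVector x c • x c +
          areaVector x i • x i = 0 → x i ∈ interior (convexHull ℝ (x '' {i}ᶜ)) := by
      intro a b c hi hcr e₁ e₂
      have ha : a ≠ i := by
        have : a ∈ ({i}ᶜ : Set (Fin 4)) := by rw [hi]; simp
        exact this
      have hb : b ≠ i := by
        have : b ∈ ({i}ᶜ : Set (Fin 4)) := by rw [hi]; simp
        exact this
      have hc : c ≠ i := by
        have : c ∈ ({i}ᶜ : Set (Fin 4)) := by rw [hi]; simp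
        exact this
      have hxi : x i = (-areaVector x a / areaVector x i) • x a +
          (-areaVector x b / areaVector x i) • x b +
          (-areaVector x c / areaVector x i) • x c := by
        have h2 : (areaVector x i : ℂ) ≠ 0 := by exact_mod_cast h₀ i
        simp only [Complex.real_smul] at e₂ ⊢
        push_cast
        field_simp
        linear_combination e₂
      rw [hcompl a b c hi, hxi]
      refine mem_interior_convexHull_triangle hcr (hpos a ha) (hpos b hb) (hpos c hc) ?_
      have h2 := h₀ i
      field_simp
      linear_combination -e₁
    have cases : i = 0 ∨ i = 1 ∨ i = 2 ∨ i = 3 := by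
      clear * -
      revert i
      decide
    rcases cases with rfl | rfl | rfl | rfl
    · exact main 1 2 3 (by ext k; fin_cases k <;> simp) (by simpa [areaVector] using h₀ 0)
        (by linear_combination e₁) (by linear_combination e₂)
    · exact main 0 2 3 (by ext k; fin_cases k <;> simp) (by simpa [areaVector] using h₀ 1)
        (by linear_combination e₁) (by linear_combination e₂)
    · exact main 0 1 3 (by ext k; fin_cases k <;> simp) (by simpa [areaVector] using h₀ 2)
        (by linear_combination e₁) (by linear_combination e₂)
    · exact main 0 1 2 (by ext k; fin_cases k <;> simp) (by simpa [areaVector] using h₀ 3)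
        (by linear_combination e₁) (by linear_combination e₂)

end Convexity
-- Normal form with the unit vortices at -1 and 1.
section Normalization

theorem IsDependency.sum_mul_sq_dist {D : Fin 4 → ℝ} {x : Fin 4 → ℂ} (h : IsDependency D x)
    (i : Fin 4) : D 0 * ‖x i - x 0‖ ^ 2 + D 1 * ‖x i - x 1‖ ^ 2 + D 2 * ‖x i - x 2‖ ^ 2 +
      D 3 * ‖x i - x 3‖ ^ 2 = D 0 * ‖x 0‖ ^ 2 + D 1 * ‖x 1‖ ^ 2 + D 2 * ‖x 2‖ ^ 2 +
      D 3 * ‖x 3‖ ^ 2 := by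
  obtain ⟨h₁, h₂, h₃⟩ := isDependency_iff.1 h
  simp only [sq_norm_sub]
  simp only [Complex.sq_norm, Complex.normSq_apply]
  linear_combination ((x i).re ^ 2 + (x i).im ^ 2) * h₁ - 2 * (x i).re * h₂ - 2 * (x i).im * h₃

theorem IsDependency.of_directlySimilar {n : ℕ} {D : Fin n → ℝ} {x y : Fin n → ℂ}
    (h : IsDependency D x) (hxy : DirectlySimilar x y) : IsDependency D y := by
  obtain ⟨a, b, -, hy⟩ := hxy
  refine ⟨h.1, ?_⟩
  have h₁ : ∑ i, (D i : ℂ) = 0 := by exact_mod_cast h.1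
  have h₂ : ∑ i, (D i : ℂ) * x i = 0 := by simpa [Complex.real_smul] using h.2
  have : ∀ i, D i • y i = a * (D i * x i) + D i * b := fun i => by
    rw [hy, Complex.real_smul]; ring
  simp only [this, Finset.sum_add_distrib, ← Finset.mul_sum, ← Finset.sum_mul, h₁, h₂]
  simp

/-- A configuration can be moved so that its first two points are `-1` and `1`. -/
theorem exists_normalization {x : Fin 4 → ℂ} (h : x 0 ≠ x 1) :
    ∃ y, DirectlySimilar x y ∧ y 0 = -1 ∧ y 1 = 1 ∧
      ∀ i j, ‖x 0 - x 1‖ ^ 2 * ‖y i - y j‖ ^ 2 = 4 * ‖x i - x j‖ ^ 2 := by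
  have h' : x 1 - x 0 ≠ 0 := sub_ne_zero.2 h.symm
  refine ⟨fun i => 2 / (x 1 - x 0) * x i + (-1 - 2 / (x 1 - x 0) * x 0),
    ⟨_, _, by simpa using h', fun i => rfl⟩, by ring, by field_simp; ring, fun i j => ?_⟩
  have : 2 / (x 1 - x 0) * x i + (-1 - 2 / (x 1 - x 0) * x 0) -
      (2 / (x 1 - x 0) * x j + (-1 - 2 / (x 1 - x 0) * x 0)) = 2 / (x 1 - x 0) * (x i - x j) := by
    ring
  rw [this, norm_mul, norm_div, norm_sub_rev (x 0)]
  have : ‖x 1 - x 0‖ ≠ 0 := norm_ne_zero_iff.2 h'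
  simp only [Complex.norm_ofNat]
  field_simp
  ring

/-- The explicit asymmetric relative equilibria, where `A ^ 2 = m + 1`, `B ^ 2 = 3 * m + 5`,
`C ^ 2 = 1 - m` and `R ^ 2 = 3`. -/
noncomputable def conf (A B C R : ℝ) : Fin 4 → ℂ :=
  ![-1, 1, ⟨B * (A + C) / 2, R * A * (A - C) / 2⟩, ⟨B * (A - C) / 2, -(R * A * (A + C) / 2)⟩]

/-- The affine dependency of the configuration `conf A B C R`. -/
def confDependency (A B C : ℝ) : Fin 4 → ℝ :=
  ![B - A, -A - B, A + C, A - C]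

theorem isDependency_conf {A B C : ℝ} (R : ℝ) (hC : A ^ 2 + C ^ 2 = 2) :
    IsDependency (confDependency A B C) (conf A B C R) := by
  rw [isDependency_iff]
  simp only [confDependency, conf, Matrix.cons_val, Complex.neg_re, Complex.neg_im, Complex.one_re,
    Complex.one_im]
  refine ⟨by ring, by linear_combination B * hC, by ring⟩

/-- The distances to ±1 give the real parts and the squares of the imaginary parts. The dependency
couples the two remaining signs, so one sign, that of R, is left. -/
theorem eq_conf {A B C : ℝ} (hC : A ^ 2 + C ^ 2 = 2) (hB : B ^ 2 = C ^ 2 + 4 * A ^ 2)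
    {y : Fin 4 → ℂ} (h0 : y 0 = -1) (h1 : y 1 = 1) (hD : IsDependency (confDependency A B C) y)
    (h02 : ‖y 0 - y 2‖ ^ 2 = (A + B) * (B + C)) (h12 : ‖y 1 - y 2‖ ^ 2 = (B - A) * (B - C))
    (h03 : ‖y 0 - y 3‖ ^ 2 = (A + B) * (B - C)) (h13 : ‖y 1 - y 3‖ ^ 2 = (B - A) * (B + C)) :
    ∃ R : ℝ, R ^ 2 = 3 ∧ y = conf A B C R := by
  obtain ⟨-, -, d⟩ := isDependency_iff.1 hD
  simp only [sq_norm_sub, h0, h1, Complex.neg_re, Complex.neg_im, Complex.one_re,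
    Complex.one_im] at h02 h12 h03 h13
  simp only [confDependency, Matrix.cons_val, h0, h1, Complex.neg_im, Complex.one_im] at d
  have r2 : (y 2).re = B * (A + C) / 2 := by linear_combination (h02 - h12) / 4
  have r3 : (y 3).re = B * (A - C) / 2 := by linear_combination (h03 - h13) / 4
  have i2 : (y 2).im ^ 2 = 3 * (A * (A - C) / 2) ^ 2 := by
    rw [r2] at h02
    linear_combination h02 + (1 - (A + C) ^ 2 / 4) * hB +
      (1 / 2 - (7 * A ^ 2 + 2 * A * C + C ^ 2) / 4) * hC
  have i3 : (y 3).im ^ 2 = 3 * (A * (A + C) / 2) ^ 2 := by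
    rw [r3] at h03
    linear_combination h03 + (1 - (A - C) ^ 2 / 4) * hB +
      (1 / 2 - (7 * A ^ 2 - 2 * A * C + C ^ 2) / 4) * hC
  suffices ∃ R : ℝ, R ^ 2 = 3 ∧ (y 2).im = R * A * (A - C) / 2 ∧
      (y 3).im = -(R * A * (A + C) / 2) by
    obtain ⟨R, hR, e2, e3⟩ := this
    refine ⟨R, hR, funext fun i => ?_⟩
    fin_cases i
    · exact h0
    · exact h1
    · exact Complex.ext r2 e2
    · exact Complex.ext r3 e3
  have h3 : √3 ^ 2 = (3 : ℝ) := Real.sq_sqrt (by norm_num)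
  -- If A + C = 0, the dependency does not involve `y 2`, but then `y 3` is real and the sign of R
  -- is read off from `y 2`.
  by_cases hAC : A + C = 0
  · have e3 : (y 3).im = 0 := by simpa [hAC] using i3
    have : (y 2).im ^ 2 = (√3 * (A * (A - C) / 2)) ^ 2 := by rw [mul_pow, h3, i2]
    rcases sq_eq_sq_iff_eq_or_eq_neg.1 this with h | h
    · exact ⟨√3, h3, by rw [h]; ring, by rw [e3, hAC]; ring⟩
    · exact ⟨-√3, by rw [neg_sq, h3], by rw [h]; ring, by rw [e3, hAC]; ring⟩
  · have : (y 3).im ^ 2 = (√3 * (A * (A + C) / 2)) ^ 2 := by rw [mul_pow, h3, i3]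
    rcases sq_eq_sq_iff_eq_or_eq_neg.1 this with h | h
    · refine ⟨-√3, by rw [neg_sq, h3], ?_, by rw [h]; ring⟩
      apply mul_left_cancel₀ hAC
      linear_combination d - (A - C) * h
    · refine ⟨√3, h3, ?_, by rw [h]; ring⟩
      apply mul_left_cancel₀ hAC
      linear_combination d - (A - C) * h

end Normalization

/-! ### Dziobek's rank-one relations. -/

section NonzeroStrength

/-- A symmetric matrix whose off-diagonal rows are proportional to `p` has rank one off the
diagonal. -/
theorem exists_rank_one {ι : Type*} {S : ι → ι → ℝ} {p : ι → ℝ} (hS : ∀ i j, S i j = S j i)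
    (h : ∀ i j k, j ≠ i → k ≠ i → S i j * p k = S i k * p j) {a b : ι} (hab : a ≠ b)
    (ha : p a ≠ 0) (hb : p b ≠ 0) : ∃ r : ℝ, ∀ i j, i ≠ j → S i j = r * (p i * p j) := by
  refine ⟨S a b / (p a * p b), fun i j hij => ?_⟩
  have key : ∀ k, k ≠ a → S a k * p b = S a b * p k := fun k hk => h a k b hk hab.symm
  field_simp
  by_cases hia : i = a
  · subst hia
    linear_combination p i * key j hij.symm
  by_cases hja : j = a
  · subst hja
    rw [hS i j]
    linear_combination p j * key i hij
  have h1 := h i j a hij.symm (Ne.symm hia)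
  rw [hS i a] at h1
  linear_combination p b * h1 + p j * key i hia

/-- Correcting the entry at `i` so that the coefficients sum to zero turns the equilibrium equation
into an affine dependency. -/
theorem rows_proportional {Γ : Fin 4 → ℝ} {x : Fin 4 → ℂ} {i : Fin 4} {s : Fin 4 → ℝ}
    (h : ∑ j, (Γ j * s j) • (x i - x j) = 0) {j k : Fin 4} (hj : j ≠ i) (hk : k ≠ i) :
    Γ j * s j * areaVector x k = Γ k * s k * areaVector x j := by
  have hE : IsDependency
      (fun j => Γ j * s j - Pi.single (M := fun _ => ℝ) i (∑ k, Γ k * s k) j) x := by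
    refine ⟨by simp, ?_⟩
    simp only [sub_smul, Finset.sum_sub_distrib]
    simp only [smul_sub, Finset.sum_sub_distrib, ← Finset.sum_smul] at h
    rw [← neg_eq_zero, ← h]
    simp [Pi.single_apply]
  have := hE.mul_areaVector j k
  simpa [Pi.single_eq_of_ne hj, Pi.single_eq_of_ne hk] using this

end NonzeroStrength
-- Classification for m ≠ 0.
section Classification

/-- The p_i matter only up to a common factor. K is chosen so that p₃ + p₄ is normalized by the
given A; B and C are then the half-differences within the two pairs. -/
theorem exists_parameters {m n p₁ p₂ p₃ p₄ A : ℝ} (hm₀ : m ≠ 0) (hm₁ : -1 < m)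
    (hA : A ^ 2 = m + 1) (hs : p₁ + p₂ + m * (p₃ + p₄) = 0) (hw : p₃ + p₄ ≠ 0)
    (hV : n * (p₁ * p₂) = m) (hX : (m + 2) * (n * (p₃ * p₄)) = -1)
    (hW : m * (m + 2) * (n * (p₃ + p₄) ^ 2) = -2 * (m + 1)) :
    ∃ K B C : ℝ, B ^ 2 = 3 * m + 5 ∧ C ^ 2 = 1 - m ∧
      K * p₁ = B - A ∧ K * p₂ = -A - B ∧ K * (m * p₃) = A + C ∧ K * (m * p₄) = A - C ∧
      (1 + n * (p₁ * p₃)) * (A + B) = B - C ∧ (1 + n * (p₁ * p₄)) * (A + B) = B + C ∧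
      (1 + n * (p₂ * p₃)) * (B - A) = B + C ∧ (1 + n * (p₂ * p₄)) * (B - A) = B - C := by
  obtain ⟨K, hK⟩ : ∃ K, K * (m * (p₃ + p₄)) = 2 * A :=
    ⟨2 * A / (m * (p₃ + p₄)), div_mul_cancel₀ _ (mul_ne_zero hm₀ hw)⟩
  obtain ⟨B, hB⟩ : ∃ B, B = K * (p₁ - p₂) / 2 := ⟨_, rfl⟩
  obtain ⟨C, hC⟩ : ∃ C, C = K * (m * (p₃ - p₄)) / 2 := ⟨_, rfl⟩
  have hKn : K ^ 2 * m = -2 * (m + 2) * n := by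
    apply mul_left_cancel₀ (mul_ne_zero hm₀ (pow_ne_zero 2 hw))
    linear_combination (K * (m * (p₃ + p₄)) + 2 * A) * hK + 4 * hA + 2 * hW
  have k₁ : K * p₁ = B - A := by linear_combination -hB + K / 2 * hs - hK / 2
  have k₂ : K * p₂ = -A - B := by linear_combination hB + K / 2 * hs - hK / 2
  have k₃ : K * (m * p₃) = A + C := by linear_combination -hC + hK / 2
  have k₄ : K * (m * p₄) = A - C := by linear_combination hC + hK / 2
  have hBA : (B - A) * (A + B) = 2 * (m + 2) := by
    apply mul_left_cancel₀ hm₀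
    linear_combination m * (A + B) * -k₁ + K * p₁ * m * k₂ - (p₁ * p₂) * hKn + 2 * (m + 2) * hV
  have hAC : (A + C) * (A - C) = 2 * m := by
    linear_combination -(A - C) * k₃ - K * (m * p₃) * k₄ + m * (p₃ * p₄) * hKn - 2 * m * hX
  have hm2 : 2 * (m + 2) ≠ 0 := by linarith
  have hne : B - A ≠ 0 := fun h => hm2 (by rw [← hBA, h, zero_mul])
  have hne' : A + B ≠ 0 := fun h => hm2 (by rw [← hBA, h, mul_zero])
  refine ⟨K, B, C, by linear_combination hBA + hA, by linear_combination hA - hAC, k₁, k₂, k₃, k₄,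
    ?_, ?_, ?_, ?_⟩
  · apply mul_left_cancel₀ hne
    linear_combination n * (p₁ * p₃) * hBA + (p₁ * p₃) * hKn - K * (m * p₃) * k₁ - (B - A) * k₃
  · apply mul_left_cancel₀ hne
    linear_combination n * (p₁ * p₄) * hBA + (p₁ * p₄) * hKn - K * (m * p₄) * k₁ - (B - A) * k₄
  · apply mul_left_cancel₀ hne'
    linear_combination n * (p₂ * p₃) * hBA + (p₂ * p₃) * hKn - K * (m * p₃) * k₂ - (-A - B) * k₃
  · apply mul_left_cancel₀ hne'
    linear_combination n * (p₂ * p₄) * hBA + (p₂ * p₄) * hKn - K * (m * p₄) * k₂ - (-A - B) * k₄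

theorem exists_conf_of_ne_zero {m : ℝ} (hm : m ∈ Set.Ioo (-1 : ℝ) 1) (hm₀ : m ≠ 0)
    {x : Fin 4 → ℂ} (hx : x ∈ asymmetricEquilibria m) :
    ∃ B C R : ℝ, B ^ 2 = 3 * m + 5 ∧ C ^ 2 = 1 - m ∧ R ^ 2 = 3 ∧
      DirectlySimilar x (conf √(m + 1) B C R) := by
  obtain ⟨hre, hpl, hsym⟩ := hx
  have hm1 : m + 1 ≠ 0 := by linarith [hm.1]
  rw [isRelativeEquilibrium_iff (by rw [sum_strength]; positivity)] at hre
  obtain ⟨hinj, l, hl, heq⟩ := hre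
  have hA : √(m + 1) ^ 2 = m + 1 := Real.sq_sqrt (by linarith [hm.1])
  generalize √(m + 1) = A at hA ⊢
  have hΓ : ∀ i, strength m i ≠ 0 := by
    intro i; fin_cases i <;> simp [strength, hm₀]
  have hs0 : ∀ i j, i ≠ j → ‖x i - x j‖ ^ 2 ≠ 0 := fun i j h =>
    pow_ne_zero _ (norm_ne_zero_iff.2 (sub_ne_zero.2 (hinj.ne h)))
  obtain ⟨p, hp⟩ : ∃ p : Fin 4 → ℝ, ∀ i, strength m i * p i = areaVector x i :=
    ⟨fun i => areaVector x i / strength m i, fun i => mul_div_cancel₀ _ (hΓ i)⟩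
  have hdep := isDependency_areaVector x
  obtain ⟨hsum, -, -⟩ := isDependency_iff.1 hdep
  simp only [← hp] at hsum
  obtain ⟨a, ha⟩ := (isStrictlyPlanar_iff hinj).1 hpl
  have hpa : p a ≠ 0 := fun h => ha (by rw [← hp, h, mul_zero])
  -- The areas sum to zero, so they cannot have exactly one nonzero entry.
  obtain ⟨b, hab, hpb⟩ : ∃ b, a ≠ b ∧ p b ≠ 0 := by
    by_contra! hcon
    have h1 : ∑ i, areaVector x i = areaVector x a := by
      refine Finset.sum_eq_single a (fun i _ hi => ?_) (by simp)
      rw [← hp, hcon i hi.symm, mul_zero]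
    exact ha (h1 ▸ hdep.1)
  obtain ⟨r, hr⟩ := exists_rank_one (S := fun i j => (‖x i - x j‖ ^ 2)⁻¹ - l) (p := p)
    (fun i j => by simp only [norm_sub_rev]) (fun i j k hj hk => by
      have h := rows_proportional (heq i) hj hk
      rw [← hp, ← hp] at h
      apply mul_left_cancel₀ (mul_ne_zero (hΓ j) (hΓ k))
      linear_combination h) hab hpa hpb
  obtain ⟨n, hn⟩ : ∃ n, r = l * n := ⟨r / l, (mul_div_cancel₀ _ hl).symm⟩
  have hd : ∀ i j, i ≠ j → ‖x i - x j‖ ^ 2 * (l * (1 + n * (p i * p j))) = 1 := fun i j h => by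
    have h1 := hr i j h
    rw [show l * (1 + n * (p i * p j)) = (‖x i - x j‖ ^ 2)⁻¹ by
      linear_combination -h1 - p i * p j * hn]
    exact mul_inv_cancel₀ (hs0 i j h)
  have ht : ∀ i j, i ≠ j → 1 + n * (p i * p j) ≠ 0 := fun i j h h0 => by
    have := hd i j h
    rw [h0] at this
    simp at this
  have hd' : ∀ i j, i ≠ j → ∀ c, c / (1 + n * (p i * p j)) = l * (c * ‖x i - x j‖ ^ 2) :=
    fun i j h c => by
      rw [div_eq_iff (ht i j h)]
      linear_combination -c * hd i j h
  have hdist : ∀ i j k, i ≠ k → j ≠ k → p i = p j → ‖x i - x k‖ ^ 2 = ‖x j - x k‖ ^ 2 := by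
    intro i j k hi hj h
    have h1 := hd i k hi
    have h2 := hd j k hj
    rw [h] at h1
    exact mul_right_cancel₀ (mul_ne_zero hl (ht j k hj)) (h1.trans h2.symm)
  have hp01 : p 0 ≠ p 1 := fun h => hsym <|
    hasLineOfSymmetry_of_equidistant (hinj.ne (show (0 : Fin 4) ≠ 1 by decide))
      fun k h0 h1 => hdist 0 1 k h0.symm h1.symm h
  have hp23 : p 2 ≠ p 3 := fun h => hsym <|
    hasLineOfSymmetry_of_equidistant (hinj.ne (show (2 : Fin 4) ≠ 3 by decide))
      fun k h0 h1 => hdist 2 3 k h0.symm h1.symm h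
  simp only [strength, Matrix.cons_val, one_mul] at hsum
  -- Otherwise p₁ = -p₀ and p₃ = -p₂ (in the indexing of `Fin 4`), which gives an isosceles
  -- trapezoid; the dependency supplies its parallel sides.
  have hw : p 2 + p 3 ≠ 0 := fun h => by
    have h3 : p 3 = -p 2 := by linear_combination h
    have h1 : p 1 = -p 0 := by linear_combination hsum - m * h
    have e02 : ‖x 0 - x 2‖ ^ 2 = ‖x 1 - x 3‖ ^ 2 := by
      have e1 := hd 0 2 (by decide)
      have e2 := hd 1 3 (by decide)
      rw [h1, h3, neg_mul_neg] at e2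
      exact mul_right_cancel₀ (mul_ne_zero hl (ht 0 2 (by decide))) (e1.trans e2.symm)
    have e03 : ‖x 0 - x 3‖ ^ 2 = ‖x 1 - x 2‖ ^ 2 := by
      have e1 := hd 0 3 (by decide)
      have e2 := hd 1 2 (by decide)
      rw [h1] at e2
      rw [h3, mul_neg, ← neg_mul] at e1
      exact mul_right_cancel₀ (right_ne_zero_of_mul_eq_one e2) (e1.trans e2.symm)
    have hp2 : p 2 ≠ 0 := fun h0 => hp23 (by rw [h3, h0, neg_zero])
    refine hsym (hasLineOfSymmetry_of_trapezoid (hinj.ne (by decide)) ?_ e02 e03)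
    obtain ⟨-, f1, f2⟩ := isDependency_iff.1 hdep
    simp only [← hp, strength, Matrix.cons_val, h1, h3] at f1 f2
    apply mul_left_cancel₀ (mul_ne_zero hm₀ hp2)
    linear_combination ((x 0).im - (x 1).im) * f1 - ((x 0).re - (x 1).re) * f2
  obtain ⟨hV, hX, hW⟩ := product_values (m := m) (n := n) (p₁ := p 0) (p₂ := p 1) (p₃ := p 2)
    (p₄ := p 3) hm₀ hm.1 hm.2 (by linear_combination hsum) (ht 0 1 (by decide))
    (ht 0 2 (by decide)) (ht 0 3 (by decide)) (ht 1 2 (by decide)) (ht 1 3 (by decide))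
    (ht 2 3 (by decide)) hp01 hp23 hw
    (θ := l * (areaVector x 0 * ‖x 0‖ ^ 2 + areaVector x 1 * ‖x 1‖ ^ 2 +
      areaVector x 2 * ‖x 2‖ ^ 2 + areaVector x 3 * ‖x 3‖ ^ 2))
    (by
      rw [hd' 0 1 (by decide), hd' 0 2 (by decide), hd' 0 3 (by decide),
        ← hdep.sum_mul_sq_dist 0]
      simp only [← hp, strength, Matrix.cons_val, sub_self, norm_zero]
      ring)
    (by
      rw [hd' 0 1 (by decide), hd' 1 2 (by decide), hd' 1 3 (by decide),
        ← hdep.sum_mul_sq_dist 1, norm_sub_rev (x 0) (x 1)]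
      simp only [← hp, strength, Matrix.cons_val, sub_self, norm_zero]
      ring)
    (by
      rw [hd' 0 2 (by decide), hd' 1 2 (by decide), hd' 2 3 (by decide),
        ← hdep.sum_mul_sq_dist 2, norm_sub_rev (x 0) (x 2), norm_sub_rev (x 1) (x 2)]
      simp only [← hp, strength, Matrix.cons_val, sub_self, norm_zero]
      ring)
    (by
      rw [hd' 0 3 (by decide), hd' 1 3 (by decide), hd' 2 3 (by decide),
        ← hdep.sum_mul_sq_dist 3, norm_sub_rev (x 0) (x 3), norm_sub_rev (x 1) (x 3),
        norm_sub_rev (x 2) (x 3)]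
      simp only [← hp, strength, Matrix.cons_val, sub_self, norm_zero]
      ring)
  obtain ⟨K, B, C, hB, hC, k₁, k₂, k₃, k₄, t02, t03, t12, t13⟩ :=
    exists_parameters hm₀ hm.1 hA (by linear_combination hsum) hw hV hX hW
  have h01 := hd 0 1 (by decide)
  rw [hV, add_comm 1 m, ← hA] at h01
  have hBC : (B - C) * (B + C) = 4 * A ^ 2 := by linear_combination hB - hC - 4 * hA
  obtain ⟨y, hxy, hy0, hy1, hy⟩ := exists_normalization (hinj.ne (show (0 : Fin 4) ≠ 1 by decide))
  -- Since 1 + n p₀p₁ = A² and the first side now has squared length 4, every squared distance is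
  -- 4A² / (1 + n p_i p_j).
  have hydist : ∀ i j (u v w : ℝ), i ≠ j → (1 + n * (p i * p j)) * u = v → v * w = 4 * A ^ 2 →
      ‖y i - y j‖ ^ 2 = u * w := by
    intro i j u v w hij h1 h2
    apply mul_left_cancel₀ (hs0 0 1 (by decide))
    rw [hy]
    have h3 := hd i j hij
    linear_combination (-4 * ‖x i - x j‖ ^ 2) * h01 +
      (‖x i - x j‖ ^ 2 * ‖x 0 - x 1‖ ^ 2 * l) * (-h2 - w * h1) + ‖x 0 - x 1‖ ^ 2 * u * w * h3
  have hdepx : IsDependency (confDependency A B C) x := by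
    have : confDependency A B C = fun i => K * areaVector x i := by
      funext i
      rw [← hp]
      fin_cases i <;> simp [confDependency, strength, k₁, k₂, k₃, k₄]
    rw [this]
    refine ⟨by rw [← Finset.mul_sum, hdep.1, mul_zero], ?_⟩
    simp only [mul_smul, ← Finset.smul_sum, hdep.2, smul_zero]
  obtain ⟨R, hR, rfl⟩ := eq_conf (by linear_combination hA + hC)
    (by linear_combination hB - hC - 4 * hA) hy0 hy1 (hdepx.of_directlySimilar hxy)
    (hydist 0 2 _ _ _ (by decide) t02 hBC)
    (hydist 1 2 _ _ _ (by decide) t12 (by linear_combination hBC))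
    (hydist 0 3 _ _ _ (by decide) t03 (by linear_combination hBC))
    (hydist 1 3 _ _ _ (by decide) t13 hBC)
  exact ⟨B, C, R, hB, hC, hR, hxy⟩

end Classification
-- The case m = 0.
section ZeroStrength

theorem IsStrictlyPlanar.of_directlySimilar {n : ℕ} {x y : Fin n → ℂ} (h : IsStrictlyPlanar x)
    (hxy : DirectlySimilar x y) : IsStrictlyPlanar y := by
  obtain ⟨a, b, -, hx⟩ := hxy.symm
  intro hy
  apply h
  obtain ⟨p, v, hv⟩ := (collinear_iff_exists_forall_eq_smul_vadd _).1 hy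
  refine (collinear_iff_exists_forall_eq_smul_vadd _).2 ⟨a * p + b, a * v, ?_⟩
  rintro _ ⟨i, rfl⟩
  obtain ⟨r, hr⟩ := hv (y i) (Set.mem_range_self i)
  refine ⟨r, ?_⟩
  rw [hx, hr]
  simp only [vadd_eq_add, Complex.real_smul]
  ring

/-- The equilibria of a vortex of strength zero in the field of two unit vortices at `-1`, `1`. -/
theorem restricted_equilibria {z : ℂ} (h₁ : z ≠ -1) (h₂ : z ≠ 1)
    (h : (4 / ‖z + 1‖ ^ 2 - 1) • (z + 1) + (4 / ‖z - 1‖ ^ 2 - 1) • (z - 1) = 0) :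
    (z.re = 0 ∧ z.im ^ 2 = 3) ∨ (z.re = 0 ∧ z.im = 0) ∨ (z.re ^ 2 = 5 ∧ z.im = 0) := by
  have n₁ : ‖z + 1‖ ^ 2 ≠ 0 :=
    pow_ne_zero _ (norm_ne_zero_iff.2 fun h => h₁ (eq_neg_of_add_eq_zero_left h))
  have n₂ : ‖z - 1‖ ^ 2 ≠ 0 := pow_ne_zero _ (norm_ne_zero_iff.2 (sub_ne_zero.2 h₂))
  have e₁ : ‖z + 1‖ ^ 2 = (z.re + 1) ^ 2 + z.im ^ 2 := by
    rw [Complex.sq_norm, Complex.normSq_apply]; simp; ring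
  have e₂ : ‖z - 1‖ ^ 2 = (z.re - 1) ^ 2 + z.im ^ 2 := by
    rw [Complex.sq_norm, Complex.normSq_apply]; simp; ring
  generalize ‖z + 1‖ ^ 2 = s at *
  generalize ‖z - 1‖ ^ 2 = t at *
  have hre := congrArg Complex.re h
  have him := congrArg Complex.im h
  simp only [Complex.add_re, Complex.sub_re, Complex.add_im, Complex.sub_im, Complex.smul_re,
    Complex.smul_im, Complex.one_re, Complex.one_im, Complex.zero_re, Complex.zero_im, add_zero,
    sub_zero, smul_eq_mul, ← add_mul] at hre him
  rcases mul_eq_zero.1 him with h0 | h0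
  · left
    -- Off the real axis the two coefficients must both vanish, so the point forms an equilateral
    -- triangle with ±1.
    have hs : 4 / s - 1 = 0 := by linear_combination (hre + (1 - z.re) * h0) / 2
    have ht : 4 / t - 1 = 0 := by linear_combination h0 - hs
    field_simp at hs ht
    have hz : z.re = 0 := by linear_combination (ht - hs + e₂ - e₁) / 4
    exact ⟨hz, by rw [hz] at e₁; linear_combination -e₁ - hs⟩
  · right
    rw [h0] at e₁ e₂
    rw [e₁, e₂] at hre
    have m₁ : z.re + 1 ≠ 0 := fun h => n₁ (by rw [e₁, h]; ring)
    have m₂ : z.re - 1 ≠ 0 := fun h => n₂ (by rw [e₂, h]; ring)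
    simp only [ne_eq, OfNat.ofNat_ne_zero, not_false_eq_true, zero_pow, add_zero] at hre
    field_simp at hre
    have : z.re * (z.re ^ 2 - 5) = 0 := by linear_combination -hre / 2
    rcases mul_eq_zero.1 this with h | h
    · exact Or.inl ⟨h, h0⟩
    · exact Or.inr ⟨by linear_combination h, h0⟩

/-- The unit vortices alone determine `l`, and each zero vortex sits independently at ±i√3, 0 or
±√5. Planarity and asymmetry require one at ±i√3 and the other at ±√5; C = ±1 records which is
which. -/
theorem exists_conf_of_zero {x : Fin 4 → ℂ} (hx : x ∈ asymmetricEquilibria 0) :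
    ∃ B C R : ℝ, B ^ 2 = 5 ∧ C ^ 2 = 1 ∧ R ^ 2 = 3 ∧ DirectlySimilar x (conf 1 B C R) := by
  obtain ⟨hre, hpl, hsym⟩ := hx
  rw [isRelativeEquilibrium_iff (by rw [sum_strength]; norm_num)] at hre
  obtain ⟨hinj, l, hl, heq⟩ := hre
  have h01 : x 0 ≠ x 1 := hinj.ne (by decide)
  have hs : ‖x 0 - x 1‖ ^ 2 ≠ 0 := pow_ne_zero _ (norm_ne_zero_iff.2 (sub_ne_zero.2 h01))
  have hl : l = (‖x 0 - x 1‖ ^ 2)⁻¹ := by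
    have h := heq 0
    simp [Fin.sum_univ_four, strength, sub_eq_zero, h01, -Complex.real_smul] at h
    exact h.symm
  obtain ⟨y, hxy, hy0, hy1, hy⟩ := exists_normalization h01
  have hypl := hpl.of_directlySimilar hxy
  have hyinj : Function.Injective y := by
    obtain ⟨a, b, ha, h⟩ := hxy
    intro i j hij
    rw [h, h] at hij
    exact hinj (mul_left_cancel₀ ha (add_right_cancel hij))
  have hyeq : ∀ k, k ≠ 0 → k ≠ 1 → strength 0 k = 0 →
      ((y k).re = 0 ∧ (y k).im ^ 2 = 3) ∨ ((y k).re = 0 ∧ (y k).im = 0) ∨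
        ((y k).re ^ 2 = 5 ∧ (y k).im = 0) := by
    intro k hk0 hk1 hk
    refine restricted_equilibria (hy0 ▸ hyinj.ne hk0) (hy1 ▸ hyinj.ne hk1) ?_
    have hS : ∀ j, j ≠ k → (‖x k - x j‖ ^ 2)⁻¹ - l =
        (‖x 0 - x 1‖ ^ 2)⁻¹ * (4 / ‖y k - y j‖ ^ 2 - 1) := by
      intro j hj
      have h1 : ‖x k - x j‖ ^ 2 ≠ 0 :=
        pow_ne_zero _ (norm_ne_zero_iff.2 (sub_ne_zero.2 (hinj.ne hj.symm)))
      have h2 : ‖y k - y j‖ ^ 2 ≠ 0 :=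
        pow_ne_zero _ (norm_ne_zero_iff.2 (sub_ne_zero.2 (hyinj.ne hj.symm)))
      rw [hl, mul_sub, mul_one, sub_left_inj]
      have h3 := hy k j
      generalize ‖x 0 - x 1‖ ^ 2 = u at *
      generalize ‖x k - x j‖ ^ 2 = v at *
      generalize ‖y k - y j‖ ^ 2 = w at *
      field_simp
      linear_combination h3
    have h := heq k
    have hz2 : strength 0 2 = 0 := rfl
    have hz3 : strength 0 3 = 0 := rfl
    have ho0 : strength 0 0 = 1 := rfl
    have ho1 : strength 0 1 = 1 := rfl
    simp only [Fin.sum_univ_four, hz2, hz3, ho0, ho1, one_smul, zero_smul, add_zero,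
      hS 0 hk0.symm, hS 1 hk1.symm, mul_smul, ← smul_add] at h
    have h' := (smul_eq_zero.1 h).resolve_left (inv_ne_zero hs)
    obtain ⟨a, b, ha, hab⟩ := hxy
    have hdiff : ∀ j, y k - y j = a * (x k - x j) := fun j => by rw [hab, hab]; ring
    have e1 : y k + 1 = y k - y 0 := by rw [hy0, sub_neg_eq_add]
    have e2 : y k - 1 = y k - y 1 := by rw [hy1]
    rw [e1, e2]
    simp only [Complex.real_smul] at h' ⊢
    linear_combination a * h' + (((4 / ‖y k - y 0‖ ^ 2 - 1 : ℝ) : ℂ)) * hdiff 0 +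
      (((4 / ‖y k - y 1‖ ^ 2 - 1 : ℝ) : ℂ)) * hdiff 1
  have hcol : ¬ ((y 2).im = 0 ∧ (y 3).im = 0) := by
    rintro ⟨h2, h3⟩
    obtain ⟨i, hi⟩ := (isStrictlyPlanar_iff hyinj).1 hypl
    revert hi
    fin_cases i <;> simp [areaVector, cross, hy0, hy1, h2, h3]
  have hequi : ¬ ((y 2).re = 0 ∧ (y 3).re = 0) := by
    rintro ⟨h2, h3⟩
    refine hsym (hasLineOfSymmetry_of_equidistant h01 fun k hk0 hk1 => ?_)
    have hk : (y k).re = 0 := by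
      have : k = 2 ∨ k = 3 := by
        clear * - hk0 hk1
        revert k
        decide
      rcases this with rfl | rfl <;> assumption
    have e0 := hy 0 k
    have e1 := hy 1 k
    rw [sq_norm_sub (y 0), hy0, hk] at e0
    rw [sq_norm_sub (y 1), hy1, hk] at e1
    simp only [Complex.neg_re, Complex.neg_im, Complex.one_re, Complex.one_im] at e0 e1
    linear_combination (e1 - e0) / 4
  rcases hyeq 2 (by decide) (by decide) rfl with ⟨r2, i2⟩ | ⟨r2, i2⟩ | ⟨r2, i2⟩ <;>
  rcases hyeq 3 (by decide) (by decide) rfl with ⟨r3, i3⟩ | ⟨r3, i3⟩ | ⟨r3, i3⟩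
  · exact absurd ⟨r2, r3⟩ hequi
  · exact absurd ⟨r2, r3⟩ hequi
  · refine ⟨(y 3).re, -1, (y 2).im, r3, by norm_num, i2, ?_⟩
    convert hxy using 1
    funext i
    fin_cases i
    · simp [conf, hy0]
    · simp [conf, hy1]
    · apply Complex.ext
      · simp [conf, r2]
      · simp [conf]
        ring
    · apply Complex.ext
      · simp [conf]
        ring
      · simp [conf, i3]
  · exact absurd ⟨r2, r3⟩ hequi
  · exact absurd ⟨r2, r3⟩ hequi
  · exact absurd ⟨i2, i3⟩ hcol
  · refine ⟨(y 2).re, 1, -(y 3).im, r2, by norm_num, by rw [neg_sq, i3], ?_⟩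
    convert hxy using 1
    funext i
    fin_cases i
    · simp [conf, hy0]
    · simp [conf, hy1]
    · apply Complex.ext
      · simp [conf]
        ring
      · simp [conf, i2]
    · apply Complex.ext
      · simp [conf, r3]
      · simp [conf]
        ring
  · exact absurd ⟨i2, i3⟩ hcol
  · exact absurd ⟨i2, i3⟩ hcol

theorem exists_conf {m : ℝ} (hm : m ∈ Set.Ioo (-1 : ℝ) 1) {x : Fin 4 → ℂ}
    (hx : x ∈ asymmetricEquilibria m) :
    ∃ B C R : ℝ, B ^ 2 = 3 * m + 5 ∧ C ^ 2 = 1 - m ∧ R ^ 2 = 3 ∧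
      DirectlySimilar x (conf √(m + 1) B C R) := by
  by_cases hm₀ : m = 0
  · subst hm₀
    simpa using exists_conf_of_zero hx
  · exact exists_conf_of_ne_zero hm hm₀ hx

end ZeroStrength

/-! ### The explicit configurations are asymmetric equilibria. -/

section Existence

theorem conf_mem {m A B C R : ℝ} (hm : m ∈ Set.Ioo (-1 : ℝ) 1) (hA : A ^ 2 = m + 1)
    (hB : B ^ 2 = 3 * m + 5) (hC : C ^ 2 = 1 - m) (hR : R ^ 2 = 3) :
    conf A B C R ∈ asymmetricEquilibria m := by
  obtain ⟨hm₁, hm₂⟩ := hm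
  have A0 : A ≠ 0 := fun h => by rw [h] at hA; linarith
  have B0 : B ≠ 0 := fun h => by rw [h] at hB; linarith
  have C0 : C ≠ 0 := fun h => by rw [h] at hC; linarith
  have R0 : R ≠ 0 := fun h => by rw [h] at hR; linarith
  have hBA : (B - A) * (A + B) = 2 * (m + 2) := by linear_combination hB - hA
  have hBC : (B - C) * (B + C) = 4 * A ^ 2 := by linear_combination hB - hC - 4 * hA
  have hB' : B ^ 2 = C ^ 2 + 4 * A ^ 2 := by linear_combination hBC
  have hC' : A ^ 2 + C ^ 2 = 2 := by linear_combination hA + hC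
  have nBA : (B - A) * (A + B) ≠ 0 := by rw [hBA]; linarith
  have nBC : (B - C) * (B + C) ≠ 0 := by rw [hBC]; positivity
  have n₁ := left_ne_zero_of_mul nBA
  have n₂ := right_ne_zero_of_mul nBA
  have n₃ := left_ne_zero_of_mul nBC
  have n₄ := right_ne_zero_of_mul nBC
  have s01 : ‖conf A B C R 0 - conf A B C R 1‖ ^ 2 = 4 := by
    rw [sq_norm_sub]; simp [conf]; norm_num
  have s02 : ‖conf A B C R 0 - conf A B C R 2‖ ^ 2 = (A + B) * (B + C) := by
    simp only [sq_norm_sub, conf, Matrix.cons_val, Complex.neg_re, Complex.neg_im, Complex.one_re,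
      Complex.one_im]
    linear_combination A ^ 2 * (A - C) ^ 2 / 4 * hR - (1 - (A + C) ^ 2 / 4) * hB' -
      (1 / 2 - (7 * A ^ 2 + 2 * A * C + C ^ 2) / 4) * hC'
  have s12 : ‖conf A B C R 1 - conf A B C R 2‖ ^ 2 = (B - A) * (B - C) := by
    simp only [sq_norm_sub, conf, Matrix.cons_val, Complex.one_re, Complex.one_im]
    linear_combination A ^ 2 * (A - C) ^ 2 / 4 * hR - (1 - (A + C) ^ 2 / 4) * hB' -
      (1 / 2 - (7 * A ^ 2 + 2 * A * C + C ^ 2) / 4) * hC'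
  have s03 : ‖conf A B C R 0 - conf A B C R 3‖ ^ 2 = (A + B) * (B - C) := by
    simp only [sq_norm_sub, conf, Matrix.cons_val, Complex.neg_re, Complex.neg_im, Complex.one_re,
      Complex.one_im]
    linear_combination A ^ 2 * (A + C) ^ 2 / 4 * hR - (1 - (A - C) ^ 2 / 4) * hB' -
      (1 / 2 - (7 * A ^ 2 - 2 * A * C + C ^ 2) / 4) * hC'
  have s13 : ‖conf A B C R 1 - conf A B C R 3‖ ^ 2 = (B - A) * (B + C) := by
    simp only [sq_norm_sub, conf, Matrix.cons_val, Complex.one_re, Complex.one_im]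
    linear_combination A ^ 2 * (A + C) ^ 2 / 4 * hR - (1 - (A - C) ^ 2 / 4) * hB' -
      (1 / 2 - (7 * A ^ 2 - 2 * A * C + C ^ 2) / 4) * hC'
  have s23 : ‖conf A B C R 2 - conf A B C R 3‖ ^ 2 = 4 * (m + 2) := by
    simp only [sq_norm_sub, conf, Matrix.cons_val]
    linear_combination A ^ 4 * hR + C ^ 2 * hB' + (C ^ 2 + 3 * A ^ 2) * hC' + 2 * (hC + 3 * hA)
  have hdep := isDependency_conf (A := A) (B := B) (C := C) R hC'
  have hne : ∀ i j, i < j → conf A B C R i ≠ conf A B C R j := by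
    intro i j hij h
    have h0 : ‖conf A B C R i - conf A B C R j‖ ^ 2 = 0 := by rw [h]; simp
    fin_cases i <;> fin_cases j <;> first | exact absurd hij (by decide) | skip
    · exact absurd (s01.symm.trans h0) (by norm_num)
    · exact mul_ne_zero n₂ n₄ (s02.symm.trans h0)
    · exact mul_ne_zero n₂ n₃ (s03.symm.trans h0)
    · exact mul_ne_zero n₁ n₃ (s12.symm.trans h0)
    · exact mul_ne_zero n₁ n₄ (s13.symm.trans h0)
    · exact absurd (s23.symm.trans h0) (by linarith)
  have hinj : Function.Injective (conf A B C R) := by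
    intro i j h
    by_contra hij
    rcases lt_or_gt_of_ne hij with h' | h'
    · exact hne i j h' h
    · exact hne j i h' h.symm
  have hpl : IsStrictlyPlanar (conf A B C R) := by
    rw [isStrictlyPlanar_iff hinj]
    by_contra! hcon
    have h2 := hcon 2
    have h3 := hcon 3
    simp only [areaVector, cross, conf, Matrix.cons_val, Complex.neg_re, Complex.neg_im,
      Complex.one_re, Complex.one_im] at h2 h3
    exact mul_ne_zero R0 (pow_ne_zero 2 A0) (by linear_combination -(h2 + h3) / 2)
  refine ⟨?_, hpl, not_hasLineOfSymmetry hinj hpl hdep ?_⟩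
  · rw [isRelativeEquilibrium_iff (by rw [sum_strength]; intro h; linarith)]
    refine ⟨hinj, (4 * A ^ 2)⁻¹, by positivity, ?_⟩
    have key : ∀ i, (∃ c : ℝ, ∀ j, j ≠ i →
        strength m j * ((‖conf A B C R i - conf A B C R j‖ ^ 2)⁻¹ - (4 * A ^ 2)⁻¹) =
          c * confDependency A B C j) →
        ∑ j, (strength m j * ((‖conf A B C R i - conf A B C R j‖ ^ 2)⁻¹ - (4 * A ^ 2)⁻¹)) •
          (conf A B C R i - conf A B C R j) = 0 := by
      rintro i ⟨c, hc⟩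
      have : ∀ j, (strength m j * ((‖conf A B C R i - conf A B C R j‖ ^ 2)⁻¹ - (4 * A ^ 2)⁻¹)) •
          (conf A B C R i - conf A B C R j) =
          c • (confDependency A B C j • conf A B C R i - confDependency A B C j • conf A B C R j) :=
        fun j => by
          by_cases hj : j = i
          · subst hj; simp
          · rw [hc j hj, mul_smul, smul_sub (confDependency A B C j)]
      simp only [this, ← Finset.smul_sum, Finset.sum_sub_distrib, ← Finset.sum_smul, hdep.1,
        hdep.2]
      simp
    have i01 : (4 : ℝ)⁻¹ - (4 * A ^ 2)⁻¹ = m / (4 * A ^ 2) := by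
      field_simp
      linear_combination hA
    have i02 : ((A + B) * (B + C))⁻¹ - (4 * A ^ 2)⁻¹ = -(A + C) / (4 * A ^ 2 * (A + B)) := by
      rw [← hBC]
      field_simp
      ring
    have i12 : ((B - A) * (B - C))⁻¹ - (4 * A ^ 2)⁻¹ = (A + C) / (4 * A ^ 2 * (B - A)) := by
      rw [← hBC]
      field_simp
      ring
    have i03 : ((A + B) * (B - C))⁻¹ - (4 * A ^ 2)⁻¹ = -(A - C) / (4 * A ^ 2 * (A + B)) := by
      rw [← hBC]
      field_simp
      ring
    have i13 : ((B - A) * (B + C))⁻¹ - (4 * A ^ 2)⁻¹ = (A - C) / (4 * A ^ 2 * (B - A)) := by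
      rw [← hBC]
      field_simp
      ring
    have i23 : (4 * (m + 2))⁻¹ - (4 * A ^ 2)⁻¹ = -2 / (4 * A ^ 2 * ((B - A) * (A + B))) := by
      have : m + 2 ≠ 0 := by linarith
      rw [hBA]
      field_simp
      linear_combination hA
    intro i
    apply key
    fin_cases i
    -- By the rank-one relation the multiplier of row i is -m / (4A² (B - A) (A + B)) times D i / Γ
    -- i. In rows 2 and 3 the factor m cancels, so the formulas also hold at m = 0.
    · refine ⟨-m / (4 * A ^ 2 * (A + B)), fun j hj => ?_⟩
      fin_cases j
      · exact absurd rfl hj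
      · change 1 * ((‖conf A B C R 0 - conf A B C R 1‖ ^ 2)⁻¹ - (4 * A ^ 2)⁻¹) =
          _ * (-A - B)
        rw [s01, i01]
        field_simp
        ring
      · change m * ((‖conf A B C R 0 - conf A B C R 2‖ ^ 2)⁻¹ - (4 * A ^ 2)⁻¹) =
          _ * (A + C)
        rw [s02, i02]
        field_simp
      · change m * ((‖conf A B C R 0 - conf A B C R 3‖ ^ 2)⁻¹ - (4 * A ^ 2)⁻¹) =
          _ * (A - C)
        rw [s03, i03]
        field_simp
    · refine ⟨m / (4 * A ^ 2 * (B - A)), fun j hj => ?_⟩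
      fin_cases j
      · change 1 * ((‖conf A B C R 1 - conf A B C R 0‖ ^ 2)⁻¹ - (4 * A ^ 2)⁻¹) =
          _ * (B - A)
        rw [norm_sub_rev, s01, i01]
        field_simp
      · exact absurd rfl hj
      · change m * ((‖conf A B C R 1 - conf A B C R 2‖ ^ 2)⁻¹ - (4 * A ^ 2)⁻¹) =
          _ * (A + C)
        rw [s12, i12]
        field_simp
      · change m * ((‖conf A B C R 1 - conf A B C R 3‖ ^ 2)⁻¹ - (4 * A ^ 2)⁻¹) =
          _ * (A - C)
        rw [s13, i13]
        field_simp
    · refine ⟨-(A + C) / (4 * A ^ 2 * ((B - A) * (A + B))), fun j hj => ?_⟩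
      fin_cases j
      · change 1 * ((‖conf A B C R 2 - conf A B C R 0‖ ^ 2)⁻¹ - (4 * A ^ 2)⁻¹) =
          _ * (B - A)
        rw [norm_sub_rev, s02, i02]
        field_simp
      · change 1 * ((‖conf A B C R 2 - conf A B C R 1‖ ^ 2)⁻¹ - (4 * A ^ 2)⁻¹) =
          _ * (-A - B)
        rw [norm_sub_rev, s12, i12]
        field_simp
        ring
      · exact absurd rfl hj
      · change m * ((‖conf A B C R 2 - conf A B C R 3‖ ^ 2)⁻¹ - (4 * A ^ 2)⁻¹) =
          _ * (A - C)
        rw [s23, i23]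
        field_simp
        linear_combination hA - hC
    · refine ⟨-(A - C) / (4 * A ^ 2 * ((B - A) * (A + B))), fun j hj => ?_⟩
      fin_cases j
      · change 1 * ((‖conf A B C R 3 - conf A B C R 0‖ ^ 2)⁻¹ - (4 * A ^ 2)⁻¹) =
          _ * (B - A)
        rw [norm_sub_rev, s03, i03]
        field_simp
      · change 1 * ((‖conf A B C R 3 - conf A B C R 1‖ ^ 2)⁻¹ - (4 * A ^ 2)⁻¹) =
          _ * (-A - B)
        rw [norm_sub_rev, s13, i13]
        field_simp
        ring
      · change m * ((‖conf A B C R 3 - conf A B C R 2‖ ^ 2)⁻¹ - (4 * A ^ 2)⁻¹) =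
          _ * (A + C)
        rw [norm_sub_rev, s23, i23]
        field_simp
        linear_combination hA - hC
      · exact absurd rfl hj
  -- Up to nonzero constants, differences of squared coefficients factor into A, B, C, B ± C and the
  -- four factors treated here.
  · have m₁ : (B - C - 2 * A) * (B - C + 2 * A) ≠ 0 := by
      rw [show (B - C - 2 * A) * (B - C + 2 * A) = -2 * (C * (B - C)) by linear_combination hBC]
      exact mul_ne_zero (by norm_num) (mul_ne_zero C0 n₃)
    have m₂ : (B + C - 2 * A) * (B + C + 2 * A) ≠ 0 := by
      rw [show (B + C - 2 * A) * (B + C + 2 * A) = 2 * (C * (B + C)) by linear_combination hBC]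
      exact mul_ne_zero (by norm_num) (mul_ne_zero C0 n₄)
    have d01 : (B - A) ^ 2 ≠ (-A - B) ^ 2 := fun h =>
      mul_ne_zero A0 B0 (by linear_combination -h / 4)
    have d02 : (B - A) ^ 2 ≠ (A + C) ^ 2 := fun h =>
      mul_ne_zero (left_ne_zero_of_mul m₁) n₄ (by linear_combination h)
    have d03 : (B - A) ^ 2 ≠ (A - C) ^ 2 := fun h =>
      mul_ne_zero (left_ne_zero_of_mul m₂) n₃ (by linear_combination h)
    have d12 : (-A - B) ^ 2 ≠ (A + C) ^ 2 := fun h =>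
      mul_ne_zero (right_ne_zero_of_mul m₂) n₃ (by linear_combination h)
    have d13 : (-A - B) ^ 2 ≠ (A - C) ^ 2 := fun h =>
      mul_ne_zero (right_ne_zero_of_mul m₁) n₄ (by linear_combination h)
    have d23 : (A + C) ^ 2 ≠ (A - C) ^ 2 := fun h =>
      mul_ne_zero A0 C0 (by linear_combination h / 4)
    intro i j hij
    fin_cases i <;> fin_cases j <;>
      first
      | rfl
      | exact absurd hij d01
      | exact absurd hij.symm d01
      | exact absurd hij d02
      | exact absurd hij.symm d02
      | exact absurd hij d03
      | exact absurd hij.symm d03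
      | exact absurd hij d12
      | exact absurd hij.symm d12
      | exact absurd hij d13
      | exact absurd hij.symm d13
      | exact absurd hij d23
      | exact absurd hij.symm d23

end Existence
-- Signs of the dependency.
section Shape

theorem IsDependency.shape {D : Fin 4 → ℝ} {x : Fin 4 → ℂ} (h : IsDependency D x)
    (hx : ∃ i, areaVector x i ≠ 0) (hD : ∀ i, D i ≠ 0) :
    (∀ i, areaVector x i ≠ 0) ∧
      ∃ c : ℝ, 0 < c ∧ ∀ i j, D i * D j = c * (areaVector x i * areaVector x j) := by
  obtain ⟨c, hc⟩ := h.eq_smul_areaVector hx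
  refine ⟨fun i h0 => hD i (by rw [hc, h0, mul_zero]), c ^ 2, ?_, fun i j => by
    rw [hc, hc]; ring⟩
  have : c ≠ 0 := fun h0 => hD 0 (by rw [hc, h0, zero_mul])
  positivity

theorem isConvex_of_isDependency {D : Fin 4 → ℝ} {x : Fin 4 → ℂ} (h : IsDependency D x)
    (hx : ∃ i, areaVector x i ≠ 0) (h01 : D 0 * D 1 < 0) (h23 : D 2 * D 3 < 0) : IsConvex x := by
  have d0 : D 0 ≠ 0 := left_ne_zero_of_mul h01.ne
  have d1 : D 1 ≠ 0 := right_ne_zero_of_mul h01.ne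
  have d2 : D 2 ≠ 0 := left_ne_zero_of_mul h23.ne
  have d3 : D 3 ≠ 0 := right_ne_zero_of_mul h23.ne
  obtain ⟨hne, c, hc, hcD⟩ := h.shape hx (by intro i; fin_cases i <;> assumption)
  have hpos : ∀ i j, 0 < D i * D j → 0 < areaVector x i * areaVector x j := fun i j hij => by
    rw [hcD] at hij
    exact (mul_pos_iff_of_pos_left hc).1 hij
  have hprod := mul_pos_of_neg_of_neg h01 h23
  refine isConvex_of_areaVector hne fun i => ?_
  rcases lt_or_gt_of_ne (mul_ne_zero d0 d2) with h02 | h02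
  · have h03 : 0 < D 0 * D 3 := by
      have : 0 < (D 0 * D 2) * (D 2 * D 3) := mul_pos_of_neg_of_neg h02 h23
      have h2 : 0 < D 2 ^ 2 := by positivity
      exact (mul_pos_iff_of_pos_left h2).1 (by linarith)
    have h12 : 0 < D 1 * D 2 := (mul_pos_iff_of_pos_left h03).1 (by linarith)
    fin_cases i
    · exact ⟨3, by decide, hpos _ _ (by rwa [mul_comm])⟩
    · exact ⟨2, by decide, hpos _ _ (by rwa [mul_comm])⟩
    · exact ⟨1, by decide, hpos _ _ h12⟩
    · exact ⟨0, by decide, hpos _ _ h03⟩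
  · have h13 : 0 < D 1 * D 3 := (mul_pos_iff_of_pos_left h02).1 (by linarith)
    fin_cases i
    · exact ⟨2, by decide, hpos _ _ (by rwa [mul_comm])⟩
    · exact ⟨3, by decide, hpos _ _ (by rwa [mul_comm])⟩
    · exact ⟨0, by decide, hpos _ _ h02⟩
    · exact ⟨1, by decide, hpos _ _ h13⟩

theorem isConcave_of_isDependency {D : Fin 4 → ℝ} {x : Fin 4 → ℂ} (h : IsDependency D x)
    (hx : ∃ i, areaVector x i ≠ 0) (h01 : D 0 * D 1 < 0) (h2 : 0 < D 2) (h3 : 0 < D 3) :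
    IsConcave x := by
  have d0 : D 0 ≠ 0 := left_ne_zero_of_mul h01.ne
  have d1 : D 1 ≠ 0 := right_ne_zero_of_mul h01.ne
  have d2 : D 2 ≠ 0 := h2.ne'
  have d3 : D 3 ≠ 0 := h3.ne'
  obtain ⟨hne, c, hc, hcD⟩ := h.shape hx (by intro i; fin_cases i <;> assumption)
  have hneg : ∀ i j, D i * D j < 0 → areaVector x i * areaVector x j < 0 := fun i j hij => by
    rw [hcD] at hij
    exact neg_of_mul_neg_right hij hc.le
  rcases lt_or_gt_of_ne d0 with h0 | h0
  · refine isConcave_of_areaVector hne (i := 0) fun j hj => hneg j 0 ?_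
    fin_cases j
    · exact absurd rfl hj
    · exact (mul_comm (D 0) (D 1)) ▸ h01
    · exact mul_neg_of_pos_of_neg h2 h0
    · exact mul_neg_of_pos_of_neg h3 h0
  · have h1 : D 1 < 0 := (pos_iff_neg_of_mul_neg h01).1 h0
    refine isConcave_of_areaVector hne (i := 1) fun j hj => hneg j 1 ?_
    fin_cases j
    · exact h01
    · exact absurd rfl hj
    · exact mul_neg_of_pos_of_neg h2 h1
    · exact mul_neg_of_pos_of_neg h3 h1

/-- For the explicit dependency D₀D₁ = A² - B², D₂D₃ = A² - C² and D₂ + D₃ = 2A. -/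
theorem exists_dependency {m : ℝ} (hm : m ∈ Set.Ioo (-1 : ℝ) 1) {x : Fin 4 → ℂ}
    (hx : x ∈ asymmetricEquilibria m) :
    (∃ i, areaVector x i ≠ 0) ∧ ∃ D, IsDependency D x ∧ D 0 * D 1 < 0 ∧ D 2 * D 3 = 2 * m ∧
      0 < D 2 + D 3 := by
  refine ⟨(isStrictlyPlanar_iff hx.1.1).1 hx.2.1, ?_⟩
  obtain ⟨B, C, R, hB, hC, -, h⟩ := exists_conf hm hx
  have hm1 : 0 < m + 1 := by linarith [hm.1]
  have hA : √(m + 1) ^ 2 = m + 1 := Real.sq_sqrt hm1.le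
  have hA0 : 0 < √(m + 1) := Real.sqrt_pos.2 hm1
  refine ⟨_, (isDependency_conf R (by linear_combination hA + hC)).of_directlySimilar h.symm,
    ?_, ?_, ?_⟩
  · simp only [confDependency, Matrix.cons_val]
    linarith
  · simp only [confDependency, Matrix.cons_val]
    linear_combination hA - hC
  · simp only [confDependency, Matrix.cons_val]
    linarith

end Shape

/-! ### Counting the similarity classes. -/

section Counting

/-- The real number `1` or `-1`. -/
noncomputable def signOf (b : Bool) : ℝ := if b then 1 else -1

theorem signOf_sq (b : Bool) : signOf b ^ 2 = 1 := by cases b <;> simp [signOf]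

theorem signOf_injective : Function.Injective signOf := by
  intro a b h
  cases a <;> cases b <;> simp_all [signOf] <;> norm_num at h

theorem signed_sqrt_sq (b : Bool) {a : ℝ} (ha : 0 ≤ a) : (signOf b * √a) ^ 2 = a := by
  rw [mul_pow, signOf_sq, one_mul, Real.sq_sqrt ha]

theorem exists_signed_sqrt {a r : ℝ} (h : r ^ 2 = a) : ∃ b, r = signOf b * √a := by
  have ha : 0 ≤ a := h ▸ sq_nonneg r
  rcases sq_eq_sq_iff_eq_or_eq_neg.1 (h.trans (Real.sq_sqrt ha).symm) with h | h
  · exact ⟨true, by simp [signOf, h]⟩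
  · exact ⟨false, by simp [signOf, h]⟩

theorem signed_sqrt_inj {a : ℝ} (ha : 0 < a) {b b' : Bool} (h : signOf b * √a = signOf b' * √a) :
    b = b' :=
  signOf_injective (mul_right_cancel₀ (Real.sqrt_pos.2 ha).ne' h)

/-- The similarity fixes -1 and 1, so it is the identity, and the other two points determine the
parameters. -/
theorem conf_directlySimilar {A B C R B' C' R' : ℝ} (hA : A ≠ 0) (hB : B ≠ 0)
    (h : DirectlySimilar (conf A B C R) (conf A B' C' R')) : B = B' ∧ C = C' ∧ R = R' := by
  obtain ⟨a, b, -, h⟩ := h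
  have h0 := h 0
  have h1 := h 1
  have h2 := h 2
  have h3 := h 3
  simp only [conf, Matrix.cons_val] at h0 h1 h2 h3
  have ha : a = 1 := by linear_combination (h0 - h1) / 2
  have hb : b = 0 := by linear_combination -(h0 + h1) / 2
  rw [ha, hb, one_mul, add_zero] at h2 h3
  have r2 := congrArg Complex.re h2
  have r3 := congrArg Complex.re h3
  have i2 := congrArg Complex.im h2
  have i3 := congrArg Complex.im h3
  simp only at r2 r3 i2 i3
  obtain rfl : B = B' := by
    apply mul_left_cancel₀ hA
    linear_combination -r2 - r3
  obtain rfl : C = C' := by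
    apply mul_left_cancel₀ hB
    linear_combination -r2 + r3
  refine ⟨rfl, rfl, ?_⟩
  apply mul_left_cancel₀ (pow_ne_zero 2 hA)
  linear_combination -i2 + i3

theorem mirror_conf (A B C R : ℝ) : mirror (conf A B C R) = conf A B C (-R) := by
  funext i
  fin_cases i
  · simp [mirror, conf]
  · simp [mirror, conf]
  · apply Complex.ext
    · simp [mirror, conf]
    · simp [mirror, conf]
      ring
  · apply Complex.ext
    · simp [mirror, conf]
    · simp [mirror, conf]
      ring

/-- The eight asymmetric equilibria, indexed by the signs of the square roots. -/
noncomputable def equilibrium (m : ℝ) (s : Bool × Bool × Bool) : Fin 4 → ℂ :=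
  conf √(m + 1) (signOf s.1 * √(3 * m + 5)) (signOf s.2.1 * √(1 - m)) (signOf s.2.2 * √3)

theorem equilibrium_mem {m : ℝ} (hm : m ∈ Set.Ioo (-1 : ℝ) 1) (s : Bool × Bool × Bool) :
    equilibrium m s ∈ asymmetricEquilibria m := by
  have h₁ := hm.1
  have h₂ := hm.2
  exact conf_mem hm (Real.sq_sqrt (by linarith)) (signed_sqrt_sq _ (by linarith))
    (signed_sqrt_sq _ (by linarith)) (signed_sqrt_sq _ (by norm_num))

theorem exists_equilibrium {m : ℝ} (hm : m ∈ Set.Ioo (-1 : ℝ) 1) {x : Fin 4 → ℂ}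
    (hx : x ∈ asymmetricEquilibria m) : ∃ s, DirectlySimilar (equilibrium m s) x := by
  obtain ⟨B, C, R, hB, hC, hR, h⟩ := exists_conf hm hx
  obtain ⟨b, rfl⟩ := exists_signed_sqrt hB
  obtain ⟨c, rfl⟩ := exists_signed_sqrt hC
  obtain ⟨r, rfl⟩ := exists_signed_sqrt hR
  exact ⟨(b, c, r), h.symm⟩

theorem equilibrium_injective {m : ℝ} (hm : m ∈ Set.Ioo (-1 : ℝ) 1) {s t : Bool × Bool × Bool}
    (h : DirectlySimilar (equilibrium m s) (equilibrium m t)) : s = t := by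
  have h₁ := hm.1
  have h₂ := hm.2
  have hA : √(m + 1) ≠ 0 := (Real.sqrt_pos.2 (by linarith)).ne'
  have hB : signOf s.1 * √(3 * m + 5) ≠ 0 := fun h0 => by
    have := signed_sqrt_sq s.1 (show 0 ≤ 3 * m + 5 by linarith)
    rw [h0] at this
    linarith
  obtain ⟨e₁, e₂, e₃⟩ := conf_directlySimilar hA hB h
  exact Prod.ext (signed_sqrt_inj (by linarith) e₁)
    (Prod.ext (signed_sqrt_inj (by linarith) e₂) (signed_sqrt_inj (by norm_num) e₃))

theorem mirror_equilibrium (m : ℝ) (b c r : Bool) :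
    mirror (equilibrium m (b, c, r)) = equilibrium m (b, c, !r) := by
  rw [equilibrium, mirror_conf, equilibrium]
  congr 1
  cases r <;> simp [signOf]

theorem ncard_direct {m : ℝ} (hm : m ∈ Set.Ioo (-1 : ℝ) 1) :
    (Quotient.mk (directSetoid 4) '' asymmetricEquilibria m).ncard = 8 := by
  have hrange : Quotient.mk (directSetoid 4) '' asymmetricEquilibria m =
      Set.range fun s => Quotient.mk (directSetoid 4) (equilibrium m s) := by
    ext q
    constructor
    · rintro ⟨x, hx, rfl⟩
      obtain ⟨s, hs⟩ := exists_equilibrium hm hx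
      exact ⟨s, Quotient.sound hs⟩
    · rintro ⟨s, rfl⟩
      exact ⟨_, equilibrium_mem hm s, rfl⟩
  rw [hrange, Set.ncard_range_of_injective fun s t h => equilibrium_injective hm (Quotient.exact h)]
  simp

/-- Reflection flips only the sign of R, so it pairs the eight classes without fixed points. -/
theorem ncard_similar {m : ℝ} (hm : m ∈ Set.Ioo (-1 : ℝ) 1) :
    (Quotient.mk (similarSetoid 4) '' asymmetricEquilibria m).ncard = 4 := by
  have hrange : Quotient.mk (similarSetoid 4) '' asymmetricEquilibria m =
      Set.range fun s : Bool × Bool =>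
        Quotient.mk (similarSetoid 4) (equilibrium m (s.1, s.2, true)) := by
    ext q
    constructor
    · rintro ⟨x, hx, rfl⟩
      obtain ⟨⟨b, c, r⟩, hs⟩ := exists_equilibrium hm hx
      refine ⟨(b, c), Quotient.sound ?_⟩
      cases r
      · exact Or.inr (by rw [mirror_equilibrium]; exact hs)
      · exact Or.inl hs
    · rintro ⟨s, rfl⟩
      exact ⟨_, equilibrium_mem hm _, rfl⟩
  rw [hrange, Set.ncard_range_of_injective]
  · simp
  · rintro ⟨b, c⟩ ⟨b', c'⟩ h
    rcases Quotient.exact h with h | h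
    · simpa using equilibrium_injective hm h
    · rw [mirror_equilibrium] at h
      simpa using equilibrium_injective hm h

end Counting
end FourVortex

theorem mainTheorem2 (m : ℝ) (hm : m ∈ Set.Ioo (-1 : ℝ) 1) :
    (Quotient.mk (FourVortex.similarSetoid 4) '' FourVortex.asymmetricEquilibria m).ncard = 4 ∧
    (Quotient.mk (FourVortex.directSetoid 4) '' FourVortex.asymmetricEquilibria m).ncard = 8 ∧
    (m < 0 → ∀ x ∈ FourVortex.asymmetricEquilibria m, FourVortex.IsConvex x) ∧
    (0 < m → ∀ x ∈ FourVortex.asymmetricEquilibria m, FourVortex.IsConcave x) := by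
  refine ⟨FourVortex.ncard_similar hm, FourVortex.ncard_direct hm, fun h x hx => ?_,
    fun h x hx => ?_⟩
  · obtain ⟨hne, D, hD, h01, h23, -⟩ := FourVortex.exists_dependency hm hx
    exact FourVortex.isConvex_of_isDependency hD hne h01 (by linarith)
  · obtain ⟨hne, D, hD, h01, h23, hpos⟩ := FourVortex.exists_dependency hm hx
    have hmul : 0 < D 2 * D 3 := by linarith
    rcases pos_and_pos_or_neg_and_neg_of_mul_pos hmul with ⟨h2, h3⟩ | ⟨h2, h3⟩
    · exact FourVortex.isConcave_of_isDependency hD hne h01 h2 h3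
    · linarith
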